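/- A finite hypergraph $\mathcal H=(V,E)$ consists of a finite set $V$ and a set $E\subseteq\mathcal P(V)$. A subhypergraph of $\mathcal H$ is a hypergraph $(V',E')$ with $V'\subseteq V$ and $E'\subseteq\{e\cap V'\mid e\in E,\ e\cap V'\neq\emptyset\}$. A path between $u,v\in V$ is a sequence $e_1,\dots,e_k$ of edges with $u\in e_1$, $v\in e_k$ and $e_i\cap e_{i+1}\ne\emptyset$ for $1\le i<k$; $\mathcal H$ is connected if there is a path between every two vertices, and a connected component of $\mathcal H$ is a subhypergraph that is maximal, with respect to the subhypergraph relation, among the connected subhypergraphs of $\mathcal H$. For $e\in E$ let $\mathcal H\setminus e=\bigl(\bigcup_{e'\in E\setminus\{e\}}e',\,E\setminus\{e\}\bigr)$, and for $A=\{e_1,\dots,e_k\}\subseteq E$ let $\mathcal H\setminus A=((\mathcal H\setminus e_1)\setminus\cdots)\setminus e_k$ (so $\mathcal H\setminus\emptyset=\mathcal H$). A join path of $A\subseteq E$ is a list $a_1\dots a_m$ in which each element of $A$ occurs exactly once and such that $a_i\cap a_j\subseteq a_k$ whenever $i\le k\le j$. An $A$-separator of $\mathcal H$ is a join path $a_1\dots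 a_m$ of $A$ such that for every connected component $C=(V_C,E_C)$ of $\mathcal H\setminus A$ and every $j$ with $a_j\cap V_C\neq\emptyset$ one has $a_i\cap V_C\subseteq a_j\cap V_C$ for all $i\le j$. **Theorem.** There is a polynomial-time algorithm $\texttt{ComputeSeparator}(\mathcal H,A)$ that, given a finite hypergraph $\mathcal H=(V,E)$ and a set $A\subseteq E$, computes an $A$-separator of $\mathcal H$ if one exists and rejects otherwise. -/

import Mathlib

universe u

namespace HyperSep

/-! ### Hypergraphs, components, join paths and separators

Hypergraphs `(V, E)` with `E ⊆ 𝒫(V)` are Mathlib's `Hypergraph`. -/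

section Hypergraphs

variable {α : Type u}

/-- `K` is a subhypergraph of `H`: `V_K ⊆ V_H` and
`E_K ⊆ {e ∩ V_K | e ∈ E_H, e ∩ V_K ≠ ∅}`. -/
def IsSub (K H : Hypergraph α) : Prop :=
  K.vertexSet ⊆ H.vertexSet ∧
    K.edgeSet ⊆ {f | f.Nonempty ∧ ∃ e ∈ H.edgeSet, f = e ∩ K.vertexSet}

/-- There is a path between `v` and `w`: a sequence `e₁, …, eₖ` of edges with `v ∈ e₁`,
`w ∈ eₖ` in which any two consecutive edges intersect. -/
def HasPath (H : Hypergraph α) (v w : α) : Prop :=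
  ∃ e ∈ H.edgeSet, ∃ f ∈ H.edgeSet, v ∈ e ∧ w ∈ f ∧ Relation.ReflTransGen H.EAdj e f

/-- There is a path between any two vertices. -/
def IsConn (H : Hypergraph α) : Prop :=
  ∀ v ∈ H.vertexSet, ∀ w ∈ H.vertexSet, HasPath H v w

/-- `C` is a connected component of `H`: a maximal connected subhypergraph of `H`. -/
def IsComponent (H C : Hypergraph α) : Prop :=
  IsSub C H ∧ IsConn C ∧ ∀ K : Hypergraph α, IsSub K H → IsConn K → IsSub C K → K = C

/-- `H ∖ A`, the result of deleting the edges in `A` one after the other; each deletion leaves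
as vertices only those covered by a remaining edge. (If `A` is empty, nothing happens.) -/
def del (H : Hypergraph α) (A : Set (Set α)) : Hypergraph α where
  vertexSet := {v | v ∈ H.vertexSet ∧ (A.Nonempty → ∃ e ∈ H.edgeSet \ A, v ∈ e)}
  edgeSet := H.edgeSet \ A
  subset_vertexSet_of_mem_edgeSet' := fun e he _ hv =>
    ⟨Hypergraph.mem_vertexSet_of_mem_edgeSet he.1 hv, fun _ => ⟨e, he, hv⟩⟩

/-- The list `P = a₁ … aₘ` is a join path of the edge set `A`: it lists every element of `A`
exactly once, and a vertex of `aᵢ ∩ aⱼ` lies in every `aₖ` with `i ≤ k ≤ j`. -/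
def IsJoinPath (A : Set (Set α)) (P : List (Set α)) : Prop :=
  P.Nodup ∧ (∀ e, e ∈ P ↔ e ∈ A) ∧
    ∀ i k j : Fin P.length, i ≤ k → k ≤ j → P.get i ∩ P.get j ⊆ P.get k

/-- The list `P = a₁ … aₘ` is an `A`-separator of `H`: it is a join path of `A`, and for every
connected component `C` of `H ∖ A`, if `aⱼ ∩ V_C ≠ ∅` then `aᵢ ∩ V_C ⊆ aⱼ ∩ V_C` for all
`i ≤ j`. -/
def IsSeparator (H : Hypergraph α) (A : Set (Set α)) (P : List (Set α)) : Prop :=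
  IsJoinPath A P ∧
    ∀ C : Hypergraph α, IsComponent (del H A) C →
      ∀ i j : Fin P.length, i ≤ j → (P.get j ∩ C.vertexSet).Nonempty →
        P.get i ∩ C.vertexSet ⊆ P.get j ∩ C.vertexSet

end Hypergraphs

/-! ### The machine model: while-programs over binary trees, with a time count

Up to polynomial factors the running time defined here is that of a multi-tape Turing machine:
a machine carries out an instruction on a value of size `n` in time `O(n)`, and conversely a
program keeps a machine's state and its tapes as one value and spends time linear in the size
of that value on each machine step. -/

/-- The data values: binary trees. -/
inductive Val : Type
  | nil : Val
  | cons : Val → Val → Val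

namespace Val

/-- The number of nodes. -/
def size : Val → ℕ
  | nil => 1
  | cons a b => 1 + a.size + b.size

/-- The first component; `nil` has none and is left alone. -/
def fst : Val → Val
  | nil => nil
  | cons a _ => a

/-- The second component; `nil` has none and is left alone. -/
def snd : Val → Val
  | nil => nil
  | cons _ b => b

/-- The list `a₁, …, aₘ` as the value `cons a₁ (cons a₂ … (cons aₘ nil))`. -/
def ofList : List Val → Val
  | [] => nil
  | a :: l => cons a (ofList l)

end Val

/-- While-programs on binary trees. A program transforms one value; `nil` counts as false and
every other value as true. -/
inductive Prog : Type
  /-- return the input -/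
  | id : Prog
  /-- return `nil` -/
  | nil : Prog
  /-- return the first component -/
  | fst : Prog
  /-- return the second component -/
  | snd : Prog
  /-- are the two components of the input equal? -/
  | eq : Prog
  /-- run both programs on the input and pair the results -/
  | pair : Prog → Prog → Prog
  /-- run the first program, then the second one on its result -/
  | seq : Prog → Prog → Prog
  /-- if the first program answers true on the input run the second one, else the third -/
  | ite : Prog → Prog → Prog → Prog
  /-- while the first program answers true on the current value, apply the second one to it -/
  | loop : Prog → Prog → Prog

/-- `p.Runs x y t`: started on `x`, the program `p` halts with result `y` after time `t`.
Every execution of an instruction, and every round of a loop, on a current value `x` is charged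
`x.size` (time to read, copy or compare all of `x`), in addition to the time spent in the
subprograms that it runs. -/
inductive Prog.Runs : Prog → Val → Val → ℕ → Prop
  | id (x) : Runs .id x x x.size
  | nil (x) : Runs .nil x .nil x.size
  | fst (x) : Runs .fst x x.fst x.size
  | snd (x) : Runs .snd x x.snd x.size
  | eq_true (a : Val) :
      Runs .eq (.cons a a) (.cons .nil .nil) (Val.cons a a).size
  | eq_false (x : Val) (h : ∀ a, x ≠ .cons a a) : Runs .eq x .nil x.size
  | pair {p q x a b s t} (hp : Runs p x a s) (hq : Runs q x b t) :
      Runs (.pair p q) x (.cons a b) (x.size + s + t)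
  | seq {p q x y z s t} (hp : Runs p x y s) (hq : Runs q y z t) :
      Runs (.seq p q) x z (x.size + s + t)
  | ite_true {c p q x b y s t} (hc : Runs c x b s) (hb : b ≠ .nil) (hp : Runs p x y t) :
      Runs (.ite c p q) x y (x.size + s + t)
  | ite_false {c p q x y s t} (hc : Runs c x .nil s) (hq : Runs q x y t) :
      Runs (.ite c p q) x y (x.size + s + t)
  | loop_stop {c p x s} (hc : Runs c x .nil s) :
      Runs (.loop c p) x x (x.size + s)
  | loop_step {c p x b y z s t r} (hc : Runs c x b s) (hb : b ≠ .nil) (hp : Runs p x y t)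
      (hl : Runs (.loop c p) y z r) :
      Runs (.loop c p) x z (x.size + s + t + r)

/-- Programs are deterministic: result and running time are determined by the input. -/
theorem Prog.Runs.det {p : Prog} {x y y' : Val} {t t' : ℕ} (h : p.Runs x y t)
    (h' : p.Runs x y' t') : y = y' ∧ t = t' := by
  induction h generalizing y' t' with
  | id x => cases h'; exact ⟨rfl, rfl⟩
  | nil x => cases h'; exact ⟨rfl, rfl⟩
  | fst x => cases h'; exact ⟨rfl, rfl⟩
  | snd x => cases h'; exact ⟨rfl, rfl⟩
  | eq_true a =>
    cases h' with
    | eq_true => exact ⟨rfl, rfl⟩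
    | eq_false _ h => exact absurd rfl (h a)
  | eq_false x hx =>
    cases h' with
    | eq_true a => exact absurd rfl (hx a)
    | eq_false => exact ⟨rfl, rfl⟩
  | pair _ _ ih₁ ih₂ =>
    cases h' with
    | pair h₁ h₂ =>
      obtain ⟨rfl, rfl⟩ := ih₁ h₁
      obtain ⟨rfl, rfl⟩ := ih₂ h₂
      exact ⟨rfl, rfl⟩
  | seq _ _ ih₁ ih₂ =>
    cases h' with
    | seq h₁ h₂ =>
      obtain ⟨rfl, rfl⟩ := ih₁ h₁
      obtain ⟨rfl, rfl⟩ := ih₂ h₂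
      exact ⟨rfl, rfl⟩
  | ite_true _ hb _ ih₁ ih₂ =>
    cases h' with
    | ite_true h₁ _ h₂ =>
      obtain ⟨rfl, rfl⟩ := ih₁ h₁
      obtain ⟨rfl, rfl⟩ := ih₂ h₂
      exact ⟨rfl, rfl⟩
    | ite_false h₁ _ => exact absurd (ih₁ h₁).1 hb
  | ite_false _ _ ih₁ ih₂ =>
    cases h' with
    | ite_true h₁ hb _ => exact absurd (ih₁ h₁).1.symm hb
    | ite_false h₁ h₂ =>
      obtain ⟨_, rfl⟩ := ih₁ h₁
      obtain ⟨rfl, rfl⟩ := ih₂ h₂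
      exact ⟨rfl, rfl⟩
  | loop_stop _ ih₁ =>
    cases h' with
    | loop_stop h₁ =>
      obtain ⟨_, rfl⟩ := ih₁ h₁
      exact ⟨rfl, rfl⟩
    | loop_step h₁ hb _ _ => exact absurd (ih₁ h₁).1.symm hb
  | loop_step _ hb _ _ ih₁ ih₂ ih₃ =>
    cases h' with
    | loop_stop h₁ => exact absurd (ih₁ h₁).1 hb
    | loop_step h₁ _ h₂ h₃ =>
      obtain ⟨rfl, rfl⟩ := ih₁ h₁
      obtain ⟨rfl, rfl⟩ := ih₂ h₂
      obtain ⟨rfl, rfl⟩ := ih₃ h₃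
      exact ⟨rfl, rfl⟩

/-! ### Encodings of inputs and outputs -/

/-- `x` encodes the list `l`, entry by entry, where `R b y` says that `y` encodes `b`. -/
def EncList {β : Type u} (R : β → Val → Prop) (l : List β) (x : Val) : Prop :=
  ∃ ys : List Val, List.Forall₂ R l ys ∧ x = Val.ofList ys

/-- `x` encodes the (finite) set `s`: it encodes some list of its elements without repetition. -/
def EncSet {β : Type u} (R : β → Val → Prop) (s : Set β) (x : Val) : Prop :=
  ∃ l : List β, l.Nodup ∧ (∀ b, b ∈ l ↔ b ∈ s) ∧ EncList R l x

/-- `x` encodes a set of vertices, each vertex being given by its name. -/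
def EncVerts {α : Type u} (name : α → Val) (e : Set α) (x : Val) : Prop :=
  EncSet (fun v y => y = name v) e x

/-- `x` encodes the input `(H, A)`, as the triple of encodings of `V`, `E` and `A`. -/
def EncInput {α : Type u} (name : α → Val) (H : Hypergraph α) (A : Set (Set α))
    (x : Val) : Prop :=
  ∃ xV xE xA : Val, x = .cons xV (.cons xE xA) ∧
    EncVerts name H.vertexSet xV ∧
    EncSet (EncVerts name) H.edgeSet xE ∧
    EncSet (EncVerts name) A xA

/-- The output `nil` means that the input is rejected. -/
def rejects (y : Val) : Prop := y = .nil

/-- The output `cons nil z` means that the list encoded by `z` is returned. -/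
def returns {α : Type u} (name : α → Val) (P : List (Set α)) (y : Val) : Prop :=
  ∃ z : Val, y = .cons .nil z ∧ EncList (EncVerts name) P z

end HyperSep

/-! Think of a separator as a linear order on `A`. The join path condition says that `c` never lies
between `a` and `b` when some vertex is in `a` and `b` but not in `c`; equivalently, `c` is then on
the same side of both, so each of the comparisons `(a, c)` and `(b, c)` forces the other. The
component condition only prescribes comparisons: `a` must come before `b` as soon as some component
`C` meets `a` and `b ∩ C` is not contained in `a`.

Closing a set of comparisons under transitivity and forcing takes polynomial time. In general a
consistent closure could still be a dead end. The heart of the proof is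
`IsCompatible.exists_extension`: if any compatible linear order exists, every compatible strict
partial order extends to one. Hence a greedy algorithm works: close the prescribed comparisons, then
try every pair in turn and keep it unless the closure becomes inconsistent. If a separator exists,
the outcome is a linear order (`solvable_of_isSolution`); conversely, a linear outcome always is a
separator.

The extension theorem is an exchange argument. Forcing partitions the ordered pairs into classes,
and reversing the class of two neighbours in a compatible linear order yields another compatible
linear order (`IsCompatibleOrder.flip`). Start from an order with fewest inversions against the
partial order and, among these, from an inverted pair that is as close together as possible. If the
pair is adjacent, reversing its class removes inversions; otherwise reversing a class without
comparable pairs brings it closer together.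

The running time comes from showing that the functions computed in polynomial time are closed under
composition, case distinction, folds with controlled growth and bounded least fixed points. -/

namespace HyperSep

/-! ### Forcing classes and extension of compatible partial orders. -/

section Combinatorics

variable {V X : Type*} {m : V → X → Prop} {R L : X → X → Prop}

/-- Some `v` belongs to `a` and to `b` but not to `c`. -/
def Splits (m : V → X → Prop) (a b c : X) : Prop :=
  ∃ v, m v a ∧ m v b ∧ ¬ m v c

theorem Splits.symm {a b c : X} (h : Splits m a b c) : Splits m b a c :=
  let ⟨v, h₁, h₂, h₃⟩ := h
  ⟨v, h₂, h₁, h₃⟩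

/-- A strict partial order in which `c` lies on the same side of `a` and of `b` whenever some
`v` belongs to `a` and `b` but not to `c`. -/
structure IsCompatible (m : V → X → Prop) (R : X → X → Prop) : Prop where
  trans : ∀ {a b c}, R a b → R b c → R a c
  irrefl : ∀ a, ¬ R a a
  left : ∀ {a b c}, Splits m a b c → R a c → R b c
  right : ∀ {a b c}, Splits m a b c → R c a → R c b

/-- A compatible linear order. -/
structure IsCompatibleOrder (m : V → X → Prop) (R : X → X → Prop) : Prop
    extends IsCompatible m R where
  total : ∀ {a b}, a ≠ b → R a b ∨ R b a

theorem IsCompatible.asymm (h : IsCompatible m R) {a b : X} (hab : R a b) : ¬ R b a :=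
  fun hba => h.irrefl a (h.trans hab hba)

/-- One of the two comparisons forces the other in every compatible order. -/
inductive Forces (m : V → X → Prop) : X × X → X × X → Prop
  | left {a b c} : Splits m a b c → Forces m (a, c) (b, c)
  | right {a b c} : Splits m a b c → Forces m (c, a) (c, b)

/-- The equivalence relation generated by forcing. -/
def Linked (m : V → X → Prop) : X × X → X × X → Prop :=
  Relation.ReflTransGen (Forces m)

theorem Forces.symm {p q : X × X} (h : Forces m p q) : Forces m q p := by
  cases h with
  | left h => exact .left h.symm
  | right h => exact .right h.symm

theorem Linked.symm {p q : X × X} (h : Linked m p q) : Linked m q p := by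
  induction h with
  | refl => exact .refl
  | tail _ h ih => exact .head h.symm ih

theorem Linked.trans {p q r : X × X} (h : Linked m p q) (h' : Linked m q r) : Linked m p r :=
  Relation.ReflTransGen.trans h h'

theorem Linked.left {p : X × X} {a b c : X} (h : Linked m p (a, c)) (hs : Splits m a b c) :
    Linked m p (b, c) := .tail h (.left hs)

theorem Linked.right {p : X × X} {a b c : X} (h : Linked m p (c, a)) (hs : Splits m a b c) :
    Linked m p (c, b) := .tail h (.right hs)

theorem Linked.swap {p q : X × X} (h : Linked m p q) : Linked m p.swap q.swap := by
  induction h with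
  | refl => exact .refl
  | tail _ h ih =>
    refine .tail ih ?_
    cases h with
    | left h => exact .right h
    | right h => exact .left h

theorem IsCompatible.of_linked (h : IsCompatible m R) {p q : X × X} (hl : Linked m p q)
    (hp : R p.1 p.2) : R q.1 q.2 := by
  induction hl with
  | refl => exact hp
  | tail _ hf ih =>
    cases hf with
    | left hs => exact h.left hs ih
    | right hs => exact h.right hs ih

/-- A chain of forcings starting at `(x, y)` can be copied with `z` as right end. A step caused by
`v` carries over directly when `v` is not in `z`. If `v` is in `z`, it forces either a comparison
against the order or one that links `(x, y)` to `(x, z)`. -/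
theorem linked_walk (hL : IsCompatible m L) {x y z : X} (hxy : L x y) (hyz : L y z)
    (hn : ¬ Linked m (x, y) (x, z)) {p : X × X} (hp : Linked m (x, y) p) :
    Linked m (x, z) (p.1, z) ∧ Linked m (y, z) (p.2, z) := by
  induction hp with
  | refl => exact ⟨.refl, .refl⟩
  | @tail q r hq hf ih =>
    have hlt := hL.of_linked hq hxy
    have hlt2 := hL.of_linked ih.2 hyz
    cases hf with
    | @left a b c hs =>
      obtain ⟨v, h₁, h₂, h₃⟩ := hs
      refine ⟨?_, ih.2⟩
      by_cases hz : m v z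
      · exact absurd (hL.left ⟨v, h₁, hz, h₃⟩ hlt) (hL.asymm hlt2)
      · exact ih.1.left ⟨v, h₁, h₂, hz⟩
    | @right a b c hs =>
      obtain ⟨v, h₁, h₂, h₃⟩ := hs
      refine ⟨ih.1, ?_⟩
      by_cases hz : m v z
      · exact absurd ((Linked.right hq ⟨v, h₁, hz, h₃⟩).trans ih.1.symm) hn
      · exact ih.2.left ⟨v, h₁, h₂, hz⟩

/-- Otherwise, walking from `(x, y)` to `(y, z)` by `linked_walk` would link `(y, z)` to `(z, z)`,
which is impossible in an irreflexive order. -/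
theorem linked_comp (hL : IsCompatible m L) {p : X × X} (hp : L p.1 p.2) {x y z : X}
    (h₁ : Linked m p (x, y)) (h₂ : Linked m p (y, z)) : Linked m p (x, z) := by
  by_contra hn
  have hxy := hL.of_linked h₁ hp
  have hyz := hL.of_linked h₂ hp
  have := (linked_walk hL hxy hyz (fun h => hn (h₁.trans h)) (h₁.symm.trans h₂)).2
  exact hL.irrefl _ (hL.of_linked this hyz)

/-- A forcing step inside the class of `(x, z)` moves one end by means of some `v`. If `v` were in
`y`, that step could also move the end to `y`, linking the class to one of the two halves. So `v`
misses `y`, and the moved end stays on its side of `y`. -/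
theorem linked_straddle (hL : IsCompatible m L) {x y z : X} (hxy : L x y) (hyz : L y z)
    (h₁ : ¬ Linked m (x, z) (x, y)) (h₂ : ¬ Linked m (x, z) (y, z)) {p : X × X}
    (hp : Linked m (x, z) p) : L p.1 y ∧ L y p.2 := by
  suffices Linked m (x, y) (p.1, y) ∧ Linked m (y, z) (y, p.2) from
    ⟨hL.of_linked this.1 hxy, hL.of_linked this.2 hyz⟩
  induction hp with
  | refl => exact ⟨.refl, .refl⟩
  | @tail q r hq hf ih =>
    cases hf with
    | @left a b c hs =>
      obtain ⟨v, h₁', h₂', h₃⟩ := hs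
      refine ⟨?_, ih.2⟩
      by_cases hz : m v y
      · exact absurd ((Linked.left hq ⟨v, h₁', hz, h₃⟩).trans ih.2.symm) h₂
      · exact ih.1.left ⟨v, h₁', h₂', hz⟩
    | @right a b c hs =>
      obtain ⟨v, h₁', h₂', h₃⟩ := hs
      refine ⟨ih.1, ?_⟩
      by_cases hz : m v y
      · exact absurd ((Linked.right hq ⟨v, h₁', hz, h₃⟩).trans ih.1.symm) h₁
      · exact ih.2.right ⟨v, h₁', h₂', hz⟩

/-- Reverse the comparisons linked to `p`. -/
def flip (m : V → X → Prop) (L : X → X → Prop) (p : X × X) (x y : X) : Prop :=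
  (L x y ∧ ¬ Linked m p (x, y)) ∨ Linked m p (y, x)

/-- Reversing a whole class respects forcing automatically; the issue is transitivity. It holds
because the class is transitive (`linked_comp`) and because a pair of the class cannot enclose an
element without one of the two halves being in the class too. -/
theorem IsCompatibleOrder.flip (hL : IsCompatibleOrder m L) {x y : X} (hxy : L x y)
    (hadj : ∀ z, L x z → ¬ L z y) : IsCompatibleOrder m (flip m L (x, y)) := by
  have hlt : ∀ {a b}, Linked m (x, y) (a, b) → L a b := fun h => hL.of_linked h hxy
  have hcomp : ∀ {a b c}, Linked m (x, y) (a, b) → Linked m (x, y) (b, c) →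
      Linked m (x, y) (a, c) := fun h h' => linked_comp hL.toIsCompatible hxy h h'
  -- If neither half were in the class, every pair of the class would straddle `b`, in particular
  -- `(x, y)`, which has nothing in between.
  have hstr : ∀ {a b c}, L a b → L b c → Linked m (x, y) (a, c) →
      Linked m (x, y) (a, b) ∨ Linked m (x, y) (b, c) := by
    intro a b c hab hbc hac
    by_contra! hn
    have := linked_straddle hL.toIsCompatible hab hbc (fun h => hn.1 (hac.trans h))
      (fun h => hn.2 (hac.trans h)) hac.symm
    exact hadj b this.1 this.2
  have hcmp : ∀ a b, a = b ∨ L a b ∨ L b a := fun a b => by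
    by_cases h : a = b
    · exact .inl h
    · exact .inr (hL.total h)
  refine ⟨⟨?_, ?_, ?_, ?_⟩, ?_⟩
  · rintro a b c (⟨hab, nab⟩ | hba) (⟨hbc, nbc⟩ | hcb)
    · exact .inl ⟨hL.trans hab hbc, fun h => (hstr hab hbc h).elim nab nbc⟩
    · rcases hcmp a c with rfl | h | h
      · exact absurd hcb nab
      · exact .inl ⟨h, fun h' => nab (hcomp h' hcb)⟩
      · exact .inr ((hstr h hab hcb).resolve_right nab)
    · rcases hcmp a c with rfl | h | h
      · exact absurd hba nbc
      · exact .inl ⟨h, fun h' => nbc (hcomp hba h')⟩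
      · exact .inr ((hstr hbc h hba).resolve_left nbc)
    · exact .inr (hcomp hcb hba)
  · rintro a (⟨h, _⟩ | h)
    · exact hL.irrefl a h
    · exact hL.irrefl a (hlt h)
  · rintro a b c hs (⟨h, hn⟩ | h)
    · exact .inl ⟨hL.left hs h, fun h' => hn (h'.left hs.symm)⟩
    · exact .inr (h.right hs)
  · rintro a b c hs (⟨h, hn⟩ | h)
    · exact .inl ⟨hL.right hs h, fun h' => hn (h'.right hs.symm)⟩
    · exact .inr (h.left hs)
  · intro a b hab
    rcases hL.total hab with h | h
    · by_cases h' : Linked m (x, y) (a, b)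
      · exact .inr (.inr h')
      · exact .inl (.inl ⟨h, h'⟩)
    · by_cases h' : Linked m (x, y) (b, a)
      · exact .inl (.inr h')
      · exact .inr (.inl ⟨h, h'⟩)

/-- If there is a compatible linear order, then every compatible partial order extends to one. -/
theorem IsCompatible.exists_extension [Finite X] (hR : IsCompatible m R)
    (hL : IsCompatibleOrder m L) :
    ∃ M, IsCompatibleOrder m M ∧ ∀ a b, R a b → M a b := by
  classical
  -- `inv` counts the pairs on which `M` contradicts `R`; `dist` counts the elements strictly
  -- between two given ones.
  let inv : (X → X → Prop) → ℕ := fun M => {p : X × X | R p.1 p.2 ∧ M p.2 p.1}.ncard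
  let dist : (X → X → Prop) × X × X → ℕ := fun t => {w | t.1 t.2.1 w ∧ t.1 w t.2.2}.ncard
  by_contra! hno
  obtain ⟨L₀, hL₀, hmin⟩ : ∃ L₀, IsCompatibleOrder m L₀ ∧
      ∀ M, IsCompatibleOrder m M → inv L₀ ≤ inv M := by
    have := exists_minimalFor_of_wellFoundedLT (IsCompatibleOrder m) inv ⟨L, hL⟩
    obtain ⟨L₀, h₀, h₁⟩ := this
    exact ⟨L₀, h₀, fun M hM => (le_total (inv L₀) (inv M)).elim id (fun h => h₁ hM h)⟩
  obtain ⟨⟨M, b, a⟩, ⟨hM, hinv, hba, hab⟩, hdist⟩ :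
      ∃ t : (X → X → Prop) × X × X, (IsCompatibleOrder m t.1 ∧ inv t.1 = inv L₀ ∧
        t.1 t.2.1 t.2.2 ∧ R t.2.2 t.2.1) ∧
        ∀ t' : (X → X → Prop) × X × X, (IsCompatibleOrder m t'.1 ∧ inv t'.1 = inv L₀ ∧
        t'.1 t'.2.1 t'.2.2 ∧ R t'.2.2 t'.2.1) → dist t ≤ dist t' := by
    obtain ⟨a, b, hab, hn⟩ := hno L₀ hL₀
    have hne : a ≠ b := fun h => hR.irrefl a (h ▸ hab)
    obtain ⟨t, h₀, h₁⟩ := exists_minimalFor_of_wellFoundedLT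
      (fun t : (X → X → Prop) × X × X => IsCompatibleOrder m t.1 ∧ inv t.1 = inv L₀ ∧
        t.1 t.2.1 t.2.2 ∧ R t.2.2 t.2.1) dist
      ⟨(L₀, b, a), hL₀, rfl, (hL₀.total hne).resolve_left hn, hab⟩
    exact ⟨t, h₀, fun t' h => (le_total (dist t) (dist t')).elim id (fun h' => h₁ h h')⟩
  simp only at hM hinv hba hab
  have hlt : ∀ {s t : Set X}, s ⊆ t → (∃ z ∈ t, z ∉ s) → s.ncard < t.ncard :=
    fun h ⟨z, h₁, h₂⟩ => Set.ncard_lt_ncard ⟨h, fun h' => h₂ (h' h₁)⟩ (Set.toFinite _)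
  -- Otherwise `(y, a)` or `(b, y)` would be an inverted pair closer together than `(b, a)`.
  have hfree : ∀ y, M b y → M y a → ¬ R a y ∧ ¬ R y b := by
    refine fun y hby hya => ⟨fun h => ?_, fun h => ?_⟩
    · refine absurd (hdist (M, y, a) ⟨hM, hinv, hya, h⟩) (not_le.2 (hlt ?_ ⟨y, ⟨hby, hya⟩, ?_⟩))
      · exact fun w hw => ⟨hM.trans hby hw.1, hw.2⟩
      · exact fun h => hM.irrefl y h.1
    · refine absurd (hdist (M, b, y) ⟨hM, hinv, hby, h⟩) (not_le.2 (hlt ?_ ⟨y, ⟨hby, hya⟩, ?_⟩))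
      · exact fun w hw => ⟨hw.1, hM.trans hw.2 hya⟩
      · exact fun h => hM.irrefl y h.2
  by_cases hbtw : ∃ y, M b y ∧ M y a
  · obtain ⟨y, ⟨hby, hya⟩, hadj⟩ : ∃ y, (M b y ∧ M y a) ∧ ∀ z, M b z → ¬ M z y := by
      have : IsTrans X M := ⟨fun _ _ _ => hM.trans⟩
      have : Std.Irrefl M := ⟨hM.irrefl⟩
      obtain ⟨y, h₁, h₂⟩ := (Finite.wellFounded_of_trans_of_irrefl M).has_min
        {y | M b y ∧ M y a} hbtw
      exact ⟨y, h₁, fun z hbz hzy => h₂ z ⟨hbz, hM.trans hzy h₁.2⟩ hzy⟩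
    obtain ⟨hay, hyb⟩ := hfree y hby hya
    have hn₁ : ¬ Linked m (b, y) (b, a) := fun h => hyb (hR.of_linked h.symm.swap hab)
    have hn₂ : ¬ Linked m (b, a) (y, a) := fun h => hay (hR.of_linked h.swap hab)
    -- The class of `(b, y)` contains no `R`-comparable pair in either direction, as this would
    -- force `R b y`, hence `R a y`, or `R y b`. So the reversal leaves `inv` unchanged.
    have hfix : ∀ {u v}, Linked m (b, y) (u, v) → ¬ R u v ∧ ¬ R v u := by
      refine fun h => ⟨fun h' => ?_, fun h' => ?_⟩
      · exact hay (hR.trans hab (hR.of_linked h.symm h'))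
      · exact hyb (hR.of_linked h.symm.swap h')
    have hM' := hM.flip hby hadj
    have hinv' : inv (flip m M (b, y)) = inv L₀ := by
      rw [← hinv]
      refine congrArg Set.ncard (Set.ext fun ⟨u, v⟩ => and_congr_right fun huv => ?_)
      constructor
      · rintro (h | h)
        · exact h.1
        · exact absurd huv (hfix h).1
      · exact fun h => .inl ⟨h, fun h' => (hfix h').2 huv⟩
    -- After the reversal `b` is still before `a`, nothing new comes between them, and `y` has left
    -- the interval.
    refine absurd (hdist (flip m M (b, y), b, a) ⟨hM', hinv', .inl ⟨hba, hn₁⟩, hab⟩)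
      (not_le.2 (hlt ?_ ⟨y, ⟨hby, hya⟩, ?_⟩))
    · rintro w ⟨h₁ | h₁, h₂ | h₂⟩
      · exact ⟨h₁.1, h₂.1⟩
      · have := (linked_walk hM.toIsCompatible hby hya hn₁ h₂).1
        exact absurd (hM.of_linked this hba) (hM.irrefl a)
      · exact absurd (linked_walk hM.toIsCompatible hby hya hn₁ h₁).2.symm hn₂
      · exact absurd (linked_walk hM.toIsCompatible hby hya hn₁ h₁).2.symm hn₂
    · rintro ⟨h | h, _⟩
      · exact h.2 .refl
      · exact hM.asymm hby (hM.of_linked h hby)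
  · push Not at hbtw
    -- Here `b` and `a` are adjacent. `R a b` forces `R` on the reverse of every pair in their
    -- class, so the reversal creates no inversion and repairs `(a, b)`.
    have hM' := hM.flip hba hbtw
    refine absurd (hmin _ hM') (not_le.2 ?_)
    rw [← hinv]
    refine Set.ncard_lt_ncard ⟨?_, fun h => ?_⟩ (Set.toFinite _)
    · rintro ⟨u, v⟩ ⟨huv, h | h⟩
      · exact ⟨huv, h.1⟩
      · exact absurd (hR.of_linked h.swap hab) (hR.asymm huv)
    · rcases (h (show (a, b) ∈ _ from ⟨hab, hba⟩)).2 with h' | h'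
      · exact h'.2 .refl
      · exact hM.asymm hba (hM.of_linked h' hba)

end Combinatorics
/-! ### Values as lists -/

namespace Val

/-- The list that a value stands for. -/
def toList : Val → List Val
  | nil => []
  | cons a b => a :: b.toList

@[simp] theorem fst_cons (a b : Val) : (cons a b).fst = a := rfl
@[simp] theorem snd_cons (a b : Val) : (cons a b).snd = b := rfl

@[simp] theorem toList_ofList (l : List Val) : (ofList l).toList = l := by
  induction l with
  | nil => rfl
  | cons a l ih => simp [ofList, toList, ih]

@[simp] theorem ofList_toList (x : Val) : ofList x.toList = x := by
  induction x with
  | nil => rfl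
  | cons a b _ ih => simp [ofList, toList, ih]

theorem size_pos (x : Val) : 1 ≤ x.size := by cases x <;> simp [size]; lia

theorem size_fst_le (x : Val) : x.fst.size ≤ x.size := by cases x <;> simp [size, fst]; lia

theorem size_snd_le (x : Val) : x.snd.size ≤ x.size := by cases x <;> simp [size, snd]

theorem length_le_size (l : List Val) : l.length ≤ (ofList l).size := by
  induction l with
  | nil => simp
  | cons a l ih => have := a.size_pos; simp only [List.length_cons, ofList, size]; lia

theorem size_le_of_mem {l : List Val} {a : Val} (h : a ∈ l) : a.size ≤ (ofList l).size := by
  induction h with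
  | head => simp only [ofList, size]; lia
  | tail _ _ ih => simp only [ofList, size]; lia

theorem size_ofList_le_of_sublist {l l' : List Val} (h : l.Sublist l') :
    (ofList l).size ≤ (ofList l').size := by
  induction h with
  | slnil => exact le_rfl
  | cons a _ ih => simp only [ofList, size]; lia
  | cons_cons a _ ih => simp only [ofList, size]; lia

theorem size_cons_le (a b : Val) (n : ℕ) :
    (cons a b).size ≤ b.size + (Polynomial.X + 1 : Polynomial ℕ).eval (n + a.size) := by
  simp only [size, Polynomial.eval_add, Polynomial.eval_X, Polynomial.eval_one]
  lia

theorem size_ofList_append_le (l l' : List Val) :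
    (ofList (l ++ l')).size ≤ (ofList l).size + (ofList l').size := by
  induction l with
  | nil => simp [ofList]
  | cons a l ih => simp only [List.cons_append, ofList, size]; lia

end Val

open Val

/-! ### Functions computed in polynomial time -/

theorem Prog.Runs.size_le {p : Prog} {x y : Val} {t : ℕ} (h : p.Runs x y t) : y.size ≤ t := by
  induction h with
  | id x => exact le_rfl
  | nil x => exact x.size_pos
  | fst x => exact x.size_fst_le
  | snd x => exact x.size_snd_le
  | eq_true a => have := a.size_pos; simp only [size]; lia
  | eq_false x => exact x.size_pos
  | @pair _ _ x _ _ _ _ _ _ ih₁ ih₂ => have := x.size_pos; simp only [size]; lia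
  | _ => lia

theorem eval_mono (q : Polynomial ℕ) {a b : ℕ} (h : a ≤ b) : q.eval a ≤ q.eval b := by
  rw [Polynomial.eval_eq_sum, Polynomial.eval_eq_sum]
  exact Finset.sum_le_sum fun i _ => Nat.mul_le_mul_left _ (Nat.pow_le_pow_left h i)

/-- `f` is computed by a program in polynomial time. -/
def PolyTime (f : Val → Val) : Prop :=
  ∃ (p : Prog) (q : Polynomial ℕ), ∀ x, ∃ t, p.Runs x (f x) t ∧ t ≤ q.eval x.size

/-- `P` is decided by a program in polynomial time. -/
def PolyDec (P : Val → Prop) : Prop :=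
  ∃ f, PolyTime f ∧ ∀ x, f x ≠ nil ↔ P x

theorem PolyTime.exists_size_le {f : Val → Val} (hf : PolyTime f) :
    ∃ q : Polynomial ℕ, ∀ x, (f x).size ≤ q.eval x.size :=
  let ⟨_, q, h⟩ := hf
  ⟨q, fun x => let ⟨_, h₁, h₂⟩ := h x; h₁.size_le.trans h₂⟩

theorem PolyTime.id : PolyTime fun x => x :=
  ⟨.id, .X, fun x => ⟨_, .id x, by simp⟩⟩

theorem PolyTime.nil : PolyTime fun _ => nil :=
  ⟨.nil, .X, fun x => ⟨_, .nil x, by simp⟩⟩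

theorem PolyTime.comp {f g : Val → Val} (hf : PolyTime f) (hg : PolyTime g) :
    PolyTime fun x => f (g x) := by
  obtain ⟨p, q, hp⟩ := hf
  obtain ⟨p', q', hp'⟩ := hg
  refine ⟨.seq p' p, .X + q' + q.comp q', fun x => ?_⟩
  obtain ⟨t', hr', ht'⟩ := hp' x
  obtain ⟨t, hr, ht⟩ := hp (g x)
  refine ⟨_, .seq hr' hr, ?_⟩
  have := eval_mono q (hr'.size_le.trans ht')
  simp only [Polynomial.eval_add, Polynomial.eval_X, Polynomial.eval_comp]
  lia

theorem PolyTime.fst {f : Val → Val} (hf : PolyTime f) : PolyTime fun x => (f x).fst :=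
  .comp ⟨.fst, .X, fun x => ⟨_, .fst x, by simp⟩⟩ hf

theorem PolyTime.snd {f : Val → Val} (hf : PolyTime f) : PolyTime fun x => (f x).snd :=
  .comp ⟨.snd, .X, fun x => ⟨_, .snd x, by simp⟩⟩ hf

theorem PolyTime.pair {f g : Val → Val} (hf : PolyTime f) (hg : PolyTime g) :
    PolyTime fun x => cons (f x) (g x) := by
  obtain ⟨p, q, hp⟩ := hf
  obtain ⟨p', q', hp'⟩ := hg
  refine ⟨.pair p p', .X + q + q', fun x => ?_⟩
  obtain ⟨t', hr', ht'⟩ := hp' x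
  obtain ⟨t, hr, ht⟩ := hp x
  refine ⟨_, .pair hr hr', ?_⟩
  simp only [Polynomial.eval_add, Polynomial.eval_X]
  lia

open Classical in
theorem PolyTime.ite {P : Val → Prop} {f g : Val → Val} (hP : PolyDec P) (hf : PolyTime f)
    (hg : PolyTime g) : PolyTime fun x => if P x then f x else g x := by
  obtain ⟨c, ⟨pc, qc, hc⟩, hcP⟩ := hP
  obtain ⟨p, q, hp⟩ := hf
  obtain ⟨p', q', hp'⟩ := hg
  refine ⟨.ite pc p p', .X + qc + q + q', fun x => ?_⟩
  obtain ⟨s, hs, hst⟩ := hc x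
  obtain ⟨t', hr', ht'⟩ := hp' x
  obtain ⟨t, hr, ht⟩ := hp x
  simp only [Polynomial.eval_add, Polynomial.eval_X]
  by_cases h : P x
  · rw [if_pos h]
    exact ⟨_, .ite_true hs ((hcP x).2 h) hr, by lia⟩
  · rw [if_neg h]
    rw [not_not.1 (mt (hcP x).1 h)] at hs
    exact ⟨_, .ite_false hs hr', by lia⟩

theorem PolyDec.ne_nil {f : Val → Val} (hf : PolyTime f) : PolyDec fun x => f x ≠ nil :=
  ⟨f, hf, fun _ => .rfl⟩

theorem PolyDec.congr {P Q : Val → Prop} (hP : PolyDec P) (h : ∀ x, P x ↔ Q x) : PolyDec Q :=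
  let ⟨f, hf, hfP⟩ := hP
  ⟨f, hf, fun x => (hfP x).trans (h x)⟩

theorem PolyDec.comp {P : Val → Prop} {f : Val → Val} (hP : PolyDec P) (hf : PolyTime f) :
    PolyDec fun x => P (f x) :=
  let ⟨g, hg, hgP⟩ := hP
  ⟨fun x => g (f x), hg.comp hf, fun x => hgP (f x)⟩

theorem PolyDec.eq {f g : Val → Val} (hf : PolyTime f) (hg : PolyTime g) :
    PolyDec fun x => f x = g x := by
  classical
  have h : PolyTime fun x => if x.fst = x.snd ∧ x ≠ Val.nil then cons .nil .nil else .nil := by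
    refine ⟨.eq, .X, fun x => ⟨x.size, ?_, by simp⟩⟩
    cases x with
    | nil => exact by simpa using Prog.Runs.eq_false .nil (by simp)
    | cons a b =>
      by_cases h : a = b
      · subst h
        simpa using Prog.Runs.eq_true a
      · simpa [h] using Prog.Runs.eq_false (cons a b) (fun c hc => h (by cases hc; rfl))
  exact ⟨_, h.comp (hf.pair hg), fun x => by simp⟩

theorem PolyDec.not {P : Val → Prop} (hP : PolyDec P) : PolyDec fun x => ¬ P x := by
  classical
  exact ⟨_, .ite hP .nil (.pair .nil .nil), fun x => by by_cases h : P x <;> simp [h]⟩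

theorem PolyDec.and {P Q : Val → Prop} (hP : PolyDec P) (hQ : PolyDec Q) :
    PolyDec fun x => P x ∧ Q x := by
  classical
  obtain ⟨f, hf, hfQ⟩ := hQ
  exact ⟨_, .ite hP hf .nil, fun x => by by_cases h : P x <;> simp [h, ← hfQ]⟩

theorem PolyDec.or {P Q : Val → Prop} (hP : PolyDec P) (hQ : PolyDec Q) :
    PolyDec fun x => P x ∨ Q x :=
  (hP.not.and hQ.not).not.congr fun x => by tauto

/-! ### Recursion along lists -/

-- The growth of the accumulator in one round must be bounded independently of its current size; a
-- mere polynomial bound would compound over the rounds. The program loops on the state `(x,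
-- accumulator, remaining list)`.
open Prog.Runs (loop_stop) in
theorem PolyTime.foldl {g : Val → Val → Val → Val} {l i : Val → Val}
    (hg : PolyTime fun z => g z.fst z.snd.fst z.snd.snd) (hl : PolyTime l) (hi : PolyTime i)
    (hb : ∃ r : Polynomial ℕ, ∀ x a b, (g x a b).size ≤ b.size + r.eval (x.size + a.size)) :
    PolyTime fun x => (l x).toList.foldl (fun b a => g x a b) (i x) := by
  obtain ⟨r, hr⟩ := hb
  have hbody : PolyTime fun s =>
      cons s.fst (cons (g s.fst s.snd.snd.fst s.snd.fst) s.snd.snd.snd) :=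
    .pair (.fst .id) (.pair (hg.comp (.pair (.fst .id) (.pair (.fst (.snd (.snd .id)))
      (.fst (.snd .id))))) (.snd (.snd (.snd .id))))
  have hcond : PolyTime fun s => s.snd.snd := .snd (.snd .id)
  obtain ⟨pb, qb, hpb⟩ := hbody
  obtain ⟨pc, qc, hpc⟩ := hcond
  -- `ρ` bounds the growth per round, `N` the accumulator, `M` the remaining list and `K` the cost
  -- of a round; `2 + x.size + N + M` bounds the size of the state, the `2` counting its two pairing
  -- nodes.
  have key : ∀ (x : Val) (ρ N M K : ℕ), (∀ n ≤ 2 + x.size + N + M, n + qc.eval n + qb.eval n ≤ K) →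
      ∀ (as : List Val) (b : Val), b.size + as.length * ρ ≤ N →
      (∀ a ∈ as, r.eval (x.size + a.size) ≤ ρ) → (ofList as).size ≤ M →
      ∃ t, (Prog.loop pc pb).Runs (cons x (cons b (ofList as)))
        (cons x (cons (as.foldl (fun b a => g x a b) b) .nil)) t ∧ t ≤ (as.length + 1) * K := by
    intro x ρ N M K hK as
    induction as with
    | nil =>
      intro b hN _ hM
      obtain ⟨t, ht, htq⟩ := hpc (cons x (cons b .nil))
      refine ⟨_, loop_stop ht, ?_⟩
      simp only [List.length_nil, ofList, size] at *
      have := hK _ (show 1 + x.size + (1 + b.size + 1) ≤ _ by lia)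
      lia
    | cons a as ih =>
      intro b hN hρ hM
      have hga := hr x a b
      have ha := hρ a (by simp)
      simp only [List.length_cons, add_mul, one_mul, ofList, size] at hN hM
      obtain ⟨t₁, h₁, hq₁⟩ := hpc (cons x (cons b (ofList (a :: as))))
      obtain ⟨t₂, h₂, hq₂⟩ := hpb (cons x (cons b (ofList (a :: as))))
      obtain ⟨t₃, h₃, hq₃⟩ := ih (g x a b) (by lia) (fun c hc => hρ c (by simp [hc])) (by lia)
      refine ⟨_, .loop_step h₁ (by simp [ofList]) h₂ h₃, ?_⟩
      have := hK (cons x (cons b (ofList (a :: as)))).size (by simp only [ofList, size]; lia)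
      simp only [List.length_cons, add_mul, one_mul] at hq₃ ⊢
      lia
  obtain ⟨ql, hql⟩ := hl.exists_size_le
  obtain ⟨qi, hqi⟩ := hi.exists_size_le
  let S : Polynomial ℕ := 2 + .X + (qi + ql * r.comp (.X + ql)) + ql
  have hloop : ∃ p' : Prog, ∃ q' : Polynomial ℕ, ∀ x, ∃ t, p'.Runs x
      (cons x (cons ((l x).toList.foldl (fun b a => g x a b) (i x)) .nil)) t ∧ t ≤ q'.eval x.size := by
    obtain ⟨p₀, q₀, h₀⟩ := PolyTime.pair .id (.pair hi hl)
    refine ⟨.seq p₀ (.loop pc pb), .X + q₀ + (ql + 1) * (S + qc.comp S + qb.comp S), fun x => ?_⟩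
    obtain ⟨t₀, h₀, ht₀⟩ := h₀ x
    have hlen : (l x).toList.length ≤ ql.eval x.size := by
      have := length_le_size (l x).toList
      rw [ofList_toList] at this
      exact this.trans (hql x)
    obtain ⟨t, ht, htq⟩ := key x (r.eval (x.size + ql.eval x.size))
      (qi.eval x.size + ql.eval x.size * r.eval (x.size + ql.eval x.size)) (ql.eval x.size)
      ((S + qc.comp S + qb.comp S).eval x.size) (fun n hn => by
        have hS : n ≤ S.eval x.size := by
          simpa [S, Polynomial.eval_comp] using hn
        have h₁ := eval_mono qc hS
        have h₂ := eval_mono qb hS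
        simp only [Polynomial.eval_add, Polynomial.eval_comp]
        lia)
      (l x).toList (i x)
      (by gcongr; exact hqi x)
      (fun a ha => by
        refine eval_mono r (Nat.add_le_add_left ((size_le_of_mem ha).trans ?_) _)
        rw [ofList_toList]; exact hql x)
      (by rw [ofList_toList]; exact hql x)
    rw [ofList_toList] at ht
    refine ⟨_, .seq h₀ ht, ?_⟩
    have : ((l x).toList.length + 1) * (S + qc.comp S + qb.comp S).eval x.size ≤
        (ql.eval x.size + 1) * (S + qc.comp S + qb.comp S).eval x.size := by gcongr
    rw [Polynomial.eval_add, Polynomial.eval_add, Polynomial.eval_mul, Polynomial.eval_add,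
      Polynomial.eval_X, Polynomial.eval_one]
    lia
  have : PolyTime fun x => cons x (cons ((l x).toList.foldl (fun b a => g x a b) (i x)) .nil) := hloop
  exact this.snd.fst

theorem PolyTime.reverse {l : Val → Val} (hl : PolyTime l) :
    PolyTime fun x => ofList (l x).toList.reverse := by
  have h := PolyTime.foldl (g := fun _ a b => cons a b) (i := fun _ => .nil)
    (.pair (.fst (.snd .id)) (.snd (.snd .id))) hl .nil
    ⟨.X + 1, fun _ a b => size_cons_le a b _⟩
  have key : ∀ (as : List Val) (b : Val), as.foldl (fun b a => cons a b) b =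
      ofList (as.reverse ++ b.toList) := by
    intro as
    induction as with
    | nil => simp
    | cons a as ih => intro b; simp [ih, toList]
  simpa [key, toList] using h

theorem PolyTime.foldr {g : Val → Val → Val → Val} {l i : Val → Val}
    (hg : PolyTime fun z => g z.fst z.snd.fst z.snd.snd) (hl : PolyTime l) (hi : PolyTime i)
    (hb : ∃ r : Polynomial ℕ, ∀ x a b, (g x a b).size ≤ b.size + r.eval (x.size + a.size)) :
    PolyTime fun x => (l x).toList.foldr (fun a b => g x a b) (i x) := by
  simpa using PolyTime.foldl hg hl.reverse hi hb

theorem PolyTime.map {f : Val → Val → Val} {l : Val → Val}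
    (hf : PolyTime fun z => f z.fst z.snd) (hl : PolyTime l) :
    PolyTime fun x => ofList ((l x).toList.map (f x)) := by
  obtain ⟨q, hq⟩ := hf.exists_size_le
  have h := PolyTime.foldr (g := fun x a b => cons (f x a) b) (i := fun _ => .nil)
    (.pair (hf.comp (.pair (.fst .id) (.fst (.snd .id)))) (.snd (.snd .id))) hl .nil
    ⟨q.comp (1 + .X) + 1, fun x a b => by
      have := hq (cons x a)
      simp only [size, fst_cons, snd_cons] at this
      simp only [size, Polynomial.eval_add, Polynomial.eval_X, Polynomial.eval_one,
        Polynomial.eval_comp, ← add_assoc]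
      lia⟩
  have key : ∀ (x : Val) (as : List Val), as.foldr (fun a b => cons (f x a) b) .nil =
      ofList (as.map (f x)) := by
    intro x as
    induction as with
    | nil => rfl
    | cons a as ih => simp [ih, ofList]
  simpa only [key] using h

theorem PolyTime.append {f g : Val → Val} (hf : PolyTime f) (hg : PolyTime g) :
    PolyTime fun x => ofList ((f x).toList ++ (g x).toList) := by
  have h := PolyTime.foldr (g := fun _ a b => cons a b)
    (.pair (.fst (.snd .id)) (.snd (.snd .id))) hf hg
    ⟨.X + 1, fun _ a b => size_cons_le a b _⟩
  have key : ∀ (as : List Val) (b : Val), as.foldr (fun a b => cons a b) b =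
      ofList (as ++ b.toList) := by
    intro as b
    induction as with
    | nil => simp
    | cons a as ih => simp [ih, ofList]
  simpa only [key] using h

theorem PolyTime.flatMap {f : Val → Val → List Val} {l : Val → Val}
    (hf : PolyTime fun z => ofList (f z.fst z.snd)) (hl : PolyTime l) :
    PolyTime fun x => ofList ((l x).toList.flatMap (f x)) := by
  obtain ⟨q, hq⟩ := hf.exists_size_le
  have happ := PolyTime.append (hf.comp (.pair (.fst .id) (.fst (.snd .id))))
    (.snd (.snd .id) : PolyTime fun z => z.snd.snd)
  have h := PolyTime.foldr (g := fun x a b => ofList (f x a ++ b.toList)) (i := fun _ => .nil)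
    (by simpa using happ) hl .nil
    ⟨q.comp (1 + .X), fun x a b => by
      have := hq (cons x a)
      have := size_ofList_append_le (f x a) b.toList
      simp only [size, fst_cons, snd_cons, ofList_toList] at *
      simp only [Polynomial.eval_add, Polynomial.eval_X, Polynomial.eval_one,
        Polynomial.eval_comp, ← add_assoc]
      lia⟩
  have key : ∀ (x : Val) (as : List Val),
      as.foldr (fun a b => ofList (f x a ++ b.toList)) .nil = ofList (as.flatMap (f x)) := by
    intro x as
    induction as with
    | nil => rfl
    | cons a as ih => simp [ih]
  simpa only [key] using h

open Classical in
/-- The entries of `l` that satisfy `P`. -/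
noncomputable def select (l : List Val) (P : Val → Prop) : List Val :=
  l.filter fun a => P a

@[simp] theorem mem_select {l : List Val} {P : Val → Prop} {a : Val} :
    a ∈ select l P ↔ a ∈ l ∧ P a := by
  simp [select]

theorem select_sublist (l : List Val) (P : Val → Prop) : (select l P).Sublist l :=
  List.filter_sublist

theorem select_sublist_select {l : List Val} {P Q : Val → Prop} (h : ∀ a ∈ l, P a → Q a) :
    (select l P).Sublist (select l Q) := by
  classical
  unfold select
  induction l with
  | nil => simp
  | cons a l ih =>
    have := ih fun b hb => h b (by simp [hb])
    have ha := h a (by simp)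
    by_cases hP : P a
    · simpa [hP, ha hP] using this
    · by_cases hQ : Q a
      · simpa [hP, hQ] using this.trans (List.sublist_cons_self _ _)
      · simpa [hP, hQ] using this

theorem PolyTime.select {P : Val → Val → Prop} {l : Val → Val}
    (hP : PolyDec fun z => P z.fst z.snd) (hl : PolyTime l) :
    PolyTime fun x => ofList (select (l x).toList (P x)) := by
  classical
  have h := PolyTime.foldr (g := fun x a b => if P x a then cons a b else b) (i := fun _ => .nil)
    (.ite (hP.comp (.pair (.fst .id) (.fst (.snd .id)))) (.pair (.fst (.snd .id)) (.snd (.snd .id)))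
      (.snd (.snd .id))) hl .nil
    ⟨.X + 1, fun x a b => by
      have := size_cons_le a b x.size
      split
      · exact this
      · lia⟩
  have key : ∀ (x : Val) (as : List Val),
      as.foldr (fun a b => if P x a then cons a b else b) .nil =
        ofList (HyperSep.select as (P x)) := by
    intro x as
    unfold HyperSep.select
    induction as with
    | nil => rfl
    | cons a as ih => by_cases h : P x a <;> simp [ih, h, ofList]
  simpa only [key] using h

theorem PolyDec.exists_mem {P : Val → Val → Prop} {l : Val → Val}
    (hP : PolyDec fun z => P z.fst z.snd) (hl : PolyTime l) :
    PolyDec fun x => ∃ a ∈ (l x).toList, P x a := by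
  refine (PolyDec.ne_nil (.select hP hl)).congr fun x => ?_
  have : ∀ as : List Val, ofList as ≠ .nil ↔ as ≠ [] := fun as => by cases as <;> simp [ofList]
  rw [this, Ne, List.eq_nil_iff_forall_not_mem]
  simp

theorem PolyDec.forall_mem {P : Val → Val → Prop} {l : Val → Val}
    (hP : PolyDec fun z => P z.fst z.snd) (hl : PolyTime l) :
    PolyDec fun x => ∀ a ∈ (l x).toList, P x a :=
  (PolyDec.exists_mem (P := fun x a => ¬ P x a) hP.not hl).not.congr fun x => by
    simp

theorem PolyDec.mem {f l : Val → Val} (hf : PolyTime f) (hl : PolyTime l) :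
    PolyDec fun x => f x ∈ (l x).toList :=
  (PolyDec.exists_mem (P := fun x a => a = f x) (.eq (.snd .id) (hf.comp (.fst .id))) hl).congr
    fun x => by simp

/-! ### Least fixed points -/

/-- The elements of `U` that `W` contains or from which `s` derives them. -/
noncomputable def derive (U : List Val) (s : List Val → Val → Prop) (W : List Val) : List Val :=
  select U fun a => a ∈ W ∨ s W a

/-- The elements of `U` obtained by `U.length` rounds of adding what `s` derives. -/
noncomputable def closure (U : List Val) (s : List Val → Val → Prop) : List Val :=
  (derive U s)^[U.length] []

/-- The rounds are a fold over the universe that ignores the entries and uses only their number. The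
accumulator always is a sublist of the universe, which bounds its size. -/
theorem PolyTime.closure {s : Val → List Val → Val → Prop} {l : Val → Val}
    (hs : PolyDec fun z => s z.fst z.snd.fst.toList z.snd.snd) (hl : PolyTime l) :
    PolyTime fun x => ofList (closure (l x).toList (s x)) := by
  obtain ⟨q, hq⟩ := hl.exists_size_le
  have hstep : PolyTime fun z => ofList (derive (l z.fst).toList (s z.fst) z.snd.snd.toList) :=
    .select (P := fun z a => a ∈ z.snd.snd.toList ∨ s z.fst z.snd.snd.toList a)
      (.or (.mem (.snd .id) (.snd (.snd (.fst .id))))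
        (hs.comp (.pair (.fst (.fst .id)) (.pair (.snd (.snd (.fst .id))) (.snd .id)))))
      (hl.comp (.fst .id))
  have h := PolyTime.foldr (g := fun x _ b => ofList (derive (l x).toList (s x) b.toList))
    hstep hl .nil ⟨q, fun x a b => by
      refine (size_ofList_le_of_sublist (select_sublist _ _)).trans ?_
      rw [ofList_toList]
      have := (hq x).trans (eval_mono q (Nat.le_add_right x.size a.size))
      lia⟩
  have key : ∀ (x : Val) (as : List Val) (U : List Val),
      as.foldr (fun _ b => ofList (derive U (s x) b.toList)) .nil =
      ofList ((derive U (s x))^[as.length] []) := by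
    intro x as U
    induction as with
    | nil => rfl
    | cons a as ih => simp [ih, Function.iterate_succ_apply', -Function.iterate_succ]
  simpa only [key, HyperSep.closure] using h

theorem closure_sublist (U : List Val) (s : List Val → Val → Prop) : (closure U s).Sublist U := by
  unfold closure
  generalize U.length = n
  cases n with
  | zero => simp
  | succ n =>
    rw [Function.iterate_succ_apply']
    exact select_sublist _ _

/-- Whatever is preserved by `s` holds throughout the closure. -/
theorem closure_induction {U : List Val} {s : List Val → Val → Prop} {P : Val → Prop}
    (hs : ∀ W, (∀ a ∈ W, P a) → ∀ a ∈ U, s W a → P a) : ∀ a ∈ closure U s, P a := by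
  unfold closure
  generalize U.length = n
  induction n with
  | zero => simp
  | succ n ih =>
    intro a ha
    rw [Function.iterate_succ_apply', derive, mem_select] at ha
    exact ha.2.elim (ih a) (hs _ ih a ha.1)

/-- The rounds form an increasing chain of sublists of `U`, since each keeps what it has; `s` need
not be monotone. Such a chain stops growing within `U.length` rounds, so the closure is a fixed
point of `derive`. -/
theorem mem_closure {U : List Val} {s : List Val → Val → Prop} {a : Val} (ha : a ∈ U)
    (hs : s (closure U s) a) : a ∈ closure U s := by
  have hsub : ∀ n, ((derive U s)^[n] []).Sublist ((derive U s)^[n + 1] []) := by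
    intro n
    cases n with
    | zero => simp
    | succ n =>
      rw [Function.iterate_succ_apply' _ (n + 1), Function.iterate_succ_apply' _ n]
      exact select_sublist_select fun b hb h => .inl (mem_select.2 ⟨hb, h⟩)
  have hfix : ∃ n ≤ U.length, derive U s ((derive U s)^[n] []) = (derive U s)^[n] [] := by
    by_contra! hn
    have hgrow : ∀ n ≤ U.length + 1, n ≤ ((derive U s)^[n] []).length := by
      intro n
      induction n with
      | zero => simp
      | succ n ih =>
        intro h
        have h₁ := ih (by lia)
        have h₂ := (hsub n).length_le
        have h₃ : ((derive U s)^[n] []).length ≠ ((derive U s)^[n + 1] []).length := fun he =>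
          hn n (by lia) ((Function.iterate_succ_apply' _ _ _).symm.trans ((hsub n).eq_of_length he).symm)
        lia
    have h₁ := hgrow _ le_rfl
    rw [Function.iterate_succ_apply'] at h₁
    have h₂ := (select_sublist U fun a => a ∈ (derive U s)^[U.length] [] ∨
      s ((derive U s)^[U.length] []) a).length_le
    unfold derive at h₁ h₂
    lia
  obtain ⟨n, hn, hfix⟩ := hfix
  have hcl : closure U s = (derive U s)^[n] [] := by
    obtain ⟨k, hk⟩ := Nat.exists_eq_add_of_le' hn
    rw [closure, hk, Function.iterate_add_apply]
    exact Function.iterate_fixed hfix k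
  rw [← hcl] at hfix
  rw [← hfix]
  exact mem_select.2 ⟨ha, .inr hs⟩

/-! ### The algorithm -/

/-- Do `e` and `f` have the same entries? -/
def SameEntries (e f : Val) : Prop :=
  (∀ v ∈ e.toList, v ∈ f.toList) ∧ ∀ v ∈ f.toList, v ∈ e.toList

/-- In the input `x = (V, E, A)`, some edge outside `A` contains `u` and `w`. -/
def Adjoins (x u w : Val) : Prop :=
  -- The same edge may be listed in different orders in `E` and in `A`, so membership in `A` cannot
  -- be tested by equality of codes.
  ∃ e ∈ x.snd.fst.toList, (¬ ∃ a ∈ x.snd.snd.toList, SameEntries e a) ∧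
    u ∈ e.toList ∧ w ∈ e.toList

/-- The pairs of entries of `l`. -/
def pairs (l : List Val) : List Val :=
  l.flatMap fun a => l.map (cons a)

/-- The pairs of vertices joined by a path of edges outside `A`. -/
noncomputable def joined (x : Val) : List Val :=
  closure (pairs x.fst.toList) fun W p =>
    -- Reflexive pairs are included even for vertices in no edge outside `A`; `Precedes` never uses
    -- them, because it requires `w` to be outside `a`.
    p.fst = p.snd ∨ ∃ v ∈ x.fst.toList, cons p.fst v ∈ W ∧ Adjoins x v p.snd

/-- A separator has to list `a` before `b`. -/
def Precedes (x a b : Val) : Prop :=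
  ∃ u ∈ a.toList, ∃ w ∈ b.toList, w ∉ a.toList ∧ cons u w ∈ joined x

/-- Some `v` is an entry of `a` and `b` but not of `c`. -/
def SplitsList (a b c : Val) : Prop :=
  ∃ v ∈ a.toList, v ∈ b.toList ∧ v ∉ c.toList

/-- The pairs `p` that have to be comparable when those in `R` and `W` are. -/
def Implies (x : Val) (R W : List Val) (p : Val) : Prop :=
  p ∈ R ∨ Precedes x p.fst p.snd ∨
    (∃ b ∈ x.snd.snd.toList, cons p.fst b ∈ W ∧ cons b p.snd ∈ W) ∨
    (∃ b ∈ x.snd.snd.toList, cons b p.snd ∈ W ∧ SplitsList b p.fst p.snd) ∨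
    ∃ b ∈ x.snd.snd.toList, cons p.fst b ∈ W ∧ SplitsList b p.snd p.fst

/-- The least relation that contains `R` and is closed under `Implies`. -/
noncomputable def hull (x : Val) (R : List Val) : List Val :=
  closure (pairs x.snd.snd.toList) (Implies x R)

/-- No element of `A` is related to itself. -/
def Consistent (x : Val) (R : List Val) : Prop :=
  ∀ a ∈ x.snd.snd.toList, cons a a ∉ R

open Classical in
/-- Add `p` to the relation `R` if that is consistent. -/
noncomputable def extend (x p : Val) (R : List Val) : List Val :=
  if Consistent x (hull x (p :: R)) then hull x (p :: R) else R

/-- A maximal consistent relation. -/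
noncomputable def maximalRel (x : Val) : List Val :=
  (pairs x.snd.snd.toList).foldr (extend x) (hull x [])

/-- Put a maximal remaining element of `A` in front of `l`. -/
noncomputable def prepend (x : Val) (l : List Val) : List Val :=
  -- `fst` takes the first candidate. Its default `nil` is irrelevant: in a linear order a candidate
  -- exists while elements remain.
  (ofList (select x.snd.snd.toList fun a => a ∉ l ∧
    ∀ b ∈ x.snd.snd.toList, b ∉ l → b = a ∨ cons b a ∈ maximalRel x)).fst :: l

/-- The elements of `A` in increasing order. -/
noncomputable def sorted (x : Val) : List Val :=
  x.snd.snd.toList.foldr (fun _ l => prepend x l) []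

/-- The relation `maximalRel x` is a linear order. -/
def Solvable (x : Val) : Prop :=
  Consistent x (maximalRel x) ∧ ∀ a ∈ x.snd.snd.toList, ∀ b ∈ x.snd.snd.toList,
    a = b ∨ cons a b ∈ maximalRel x ∨ cons b a ∈ maximalRel x

open Classical in
/-- The result of the algorithm. -/
noncomputable def separatorVal (x : Val) : Val :=
  if Solvable x then cons .nil (ofList (sorted x)) else .nil

/-! ### Its running time -/

theorem PolyDec.sameEntries {f g : Val → Val} (hf : PolyTime f) (hg : PolyTime g) :
    PolyDec fun x => SameEntries (f x) (g x) :=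
  .and (.forall_mem (P := fun x v => v ∈ (g x).toList) (.mem (.snd .id) (hg.comp (.fst .id))) hf)
    (.forall_mem (P := fun x v => v ∈ (f x).toList) (.mem (.snd .id) (hf.comp (.fst .id))) hg)

theorem PolyDec.adjoins {X u w : Val → Val} (hX : PolyTime X) (hu : PolyTime u)
    (hw : PolyTime w) : PolyDec fun x => Adjoins (X x) (u x) (w x) :=
  .exists_mem (P := fun x e => (¬ ∃ a ∈ (X x).snd.snd.toList, SameEntries e a) ∧
      u x ∈ e.toList ∧ w x ∈ e.toList)
    (.and (.not (.exists_mem (P := fun z a => SameEntries z.snd a)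
      (.sameEntries (.snd (.fst .id)) (.snd .id)) (.snd (.snd (hX.comp (.fst .id))))))
      (.and (.mem (hu.comp (.fst .id)) (.snd .id)) (.mem (hw.comp (.fst .id)) (.snd .id))))
    (.fst (.snd hX))

theorem PolyTime.pairs {l : Val → Val} (hl : PolyTime l) :
    PolyTime fun x => ofList (pairs (l x).toList) :=
  .flatMap (f := fun x a => (l x).toList.map (cons a))
    (.map (f := fun z b => cons z.snd b) (.pair (.snd (.fst .id)) (.snd .id))
      (hl.comp (.fst .id))) hl

theorem PolyTime.joined : PolyTime fun x => ofList (joined x) := by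
  have h := PolyTime.closure (l := fun x => ofList (HyperSep.pairs x.fst.toList))
    (s := fun x W p => p.fst = p.snd ∨ ∃ v ∈ x.fst.toList, cons p.fst v ∈ W ∧ Adjoins x v p.snd)
    (.or (.eq (.fst (.snd (.snd .id))) (.snd (.snd (.snd .id))))
      (.exists_mem (P := fun z v => cons z.snd.snd.fst v ∈ z.snd.fst.toList ∧
          Adjoins z.fst v z.snd.snd.snd)
        (.and (.mem (.pair (.fst (.snd (.snd (.fst .id)))) (.snd .id)) (.fst (.snd (.fst .id))))
          (.adjoins (.fst (.fst .id)) (.snd .id) (.snd (.snd (.snd (.fst .id))))))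
        (.fst (.fst .id))))
    (.pairs (.fst .id))
  simpa only [toList_ofList, HyperSep.joined] using h

theorem PolyDec.mem_list {f : Val → Val} {l : Val → List Val} (hf : PolyTime f)
    (hl : PolyTime fun x => ofList (l x)) : PolyDec fun x => f x ∈ l x := by
  simpa using PolyDec.mem hf hl

theorem PolyDec.precedes {X a b : Val → Val} (hX : PolyTime X) (ha : PolyTime a)
    (hb : PolyTime b) : PolyDec fun x => Precedes (X x) (a x) (b x) :=
  .exists_mem (P := fun x u => ∃ w ∈ (b x).toList, w ∉ (a x).toList ∧ cons u w ∈ joined (X x))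
    (.exists_mem (P := fun z w => w ∉ (a z.fst).toList ∧ cons z.snd w ∈ joined (X z.fst))
      (.and (.not (.mem (.snd .id) (ha.comp (.fst (.fst .id)))))
        (.mem_list (.pair (.snd (.fst .id)) (.snd .id))
          (PolyTime.joined.comp (hX.comp (.fst (.fst .id))))))
      (hb.comp (.fst .id)))
    ha

theorem PolyDec.splitsList {a b c : Val → Val} (ha : PolyTime a) (hb : PolyTime b)
    (hc : PolyTime c) : PolyDec fun x => SplitsList (a x) (b x) (c x) :=
  .exists_mem (P := fun x v => v ∈ (b x).toList ∧ v ∉ (c x).toList)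
    (.and (.mem (.snd .id) (hb.comp (.fst .id))) (.not (.mem (.snd .id) (hc.comp (.fst .id))))) ha

theorem PolyDec.implies {X R W p : Val → Val} (hX : PolyTime X) (hR : PolyTime R)
    (hW : PolyTime W) (hp : PolyTime p) :
    PolyDec fun x => Implies (X x) (R x).toList (W x).toList (p x) :=
  have hA : PolyTime fun x => (X x).snd.snd := .snd (.snd hX)
  have hW' : PolyTime fun z : Val => W z.fst := hW.comp (.fst .id)
  have hp₁ : PolyTime fun z : Val => (p z.fst).fst := .fst (hp.comp (.fst .id))
  have hp₂ : PolyTime fun z : Val => (p z.fst).snd := .snd (hp.comp (.fst .id))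
  .or (.mem hp hR) <| .or (.precedes hX (.fst hp) (.snd hp)) <|
  .or (.exists_mem
    (P := fun x b => cons (p x).fst b ∈ (W x).toList ∧ cons b (p x).snd ∈ (W x).toList)
    (.and (.mem (.pair hp₁ (.snd .id)) hW') (.mem (.pair (.snd .id) hp₂) hW')) hA) <|
  .or (.exists_mem
    (P := fun x b => cons b (p x).snd ∈ (W x).toList ∧ SplitsList b (p x).fst (p x).snd)
    (.and (.mem (.pair (.snd .id) hp₂) hW') (.splitsList (.snd .id) hp₁ hp₂)) hA) <|
  .exists_mem
    (P := fun x b => cons (p x).fst b ∈ (W x).toList ∧ SplitsList b (p x).snd (p x).fst)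
    (.and (.mem (.pair hp₁ (.snd .id)) hW') (.splitsList (.snd .id) hp₂ hp₁)) hA

theorem PolyTime.hull {X R : Val → Val} (hX : PolyTime X) (hR : PolyTime R) :
    PolyTime fun x => ofList (hull (X x) (R x).toList) := by
  have h := PolyTime.closure (l := fun x => ofList (HyperSep.pairs (X x).snd.snd.toList))
    (s := fun x => Implies (X x) (R x).toList)
    (.implies (hX.comp (.fst .id)) (hR.comp (.fst .id)) (.fst (.snd .id)) (.snd (.snd .id)))
    (.pairs (.snd (.snd hX)))
  simpa only [toList_ofList, HyperSep.hull] using h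

theorem PolyDec.consistent {X : Val → Val} {R : Val → List Val} (hX : PolyTime X)
    (hR : PolyTime fun x => ofList (R x)) : PolyDec fun x => Consistent (X x) (R x) :=
  .forall_mem (P := fun x a => cons a a ∉ R x)
    (.not (.mem_list (.pair (.snd .id) (.snd .id)) (hR.comp (.fst .id)))) (.snd (.snd hX))

theorem PolyTime.extend {X p R : Val → Val} (hX : PolyTime X) (hp : PolyTime p)
    (hR : PolyTime R) : PolyTime fun x => ofList (extend (X x) (p x) (R x).toList) := by
  have h : PolyTime fun x => ofList (HyperSep.hull (X x) (p x :: (R x).toList)) :=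
    hX.hull (hp.pair hR)
  simpa only [HyperSep.extend, apply_ite ofList, ofList_toList] using
    PolyTime.ite (.consistent hX h) h hR

theorem PolyTime.maximalRel : PolyTime fun x => ofList (maximalRel x) := by
  obtain ⟨q, hq⟩ := (PolyTime.pairs (.snd (.snd .id))).exists_size_le
  have h := PolyTime.foldr (g := fun x p R => ofList (HyperSep.extend x p R.toList))
    (l := fun x => ofList (HyperSep.pairs x.snd.snd.toList))
    (i := fun x => ofList (HyperSep.hull x []))
    (.extend (.fst .id) (.fst (.snd .id)) (.snd (.snd .id))) (.pairs (.snd (.snd .id)))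
    (.hull .id .nil)
    ⟨q, fun x p R => by
      have := (hq x).trans (eval_mono q (Nat.le_add_right x.size p.size))
      unfold HyperSep.extend
      split
      · have := size_ofList_le_of_sublist (closure_sublist (HyperSep.pairs x.snd.snd.toList)
          (Implies x (p :: R.toList)))
        unfold HyperSep.hull
        lia
      · simp⟩
  have key : ∀ (x : Val) (l R : List Val), l.foldr (fun p R => ofList (HyperSep.extend x p R.toList))
      (ofList R) = ofList (l.foldr (HyperSep.extend x) R) := by
    intro x l R
    induction l with
    | nil => rfl
    | cons a l ih => simp [ih]
  simpa only [key, toList_ofList, HyperSep.maximalRel] using h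

theorem PolyTime.prepend {X l : Val → Val} (hX : PolyTime X) (hl : PolyTime l) :
    PolyTime fun x => ofList (prepend (X x) (l x).toList) := by
  have hA : PolyTime fun x => (X x).snd.snd := .snd (.snd hX)
  have h := PolyTime.select (l := fun x => (X x).snd.snd) (P := fun x a => a ∉ (l x).toList ∧
    ∀ b ∈ (X x).snd.snd.toList, b ∉ (l x).toList → b = a ∨ cons b a ∈ HyperSep.maximalRel (X x))
    (.and (.not (.mem (.snd .id) (hl.comp (.fst .id))))
      (.forall_mem (P := fun z b => b ∉ (l z.fst).toList →
          b = z.snd ∨ cons b z.snd ∈ HyperSep.maximalRel (X z.fst))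
        ((PolyDec.or (.mem (.snd .id) (hl.comp (.fst (.fst .id))))
          (.or (.eq (.snd .id) (.snd (.fst .id))) (.mem_list (.pair (.snd .id) (.snd (.fst .id)))
            (PolyTime.maximalRel.comp (hX.comp (.fst (.fst .id))))))).congr
          fun z => by rw [imp_iff_not_or, not_not])
        (hA.comp (.fst .id)))) hA
  simpa only [HyperSep.prepend, ofList, ofList_toList] using h.fst.pair hl

theorem PolyTime.sorted : PolyTime fun x => ofList (sorted x) := by
  have h := PolyTime.foldr (g := fun x _ l => ofList (HyperSep.prepend x l.toList))
    (l := fun x => x.snd.snd) (i := fun _ => .nil)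
    (.prepend (.fst .id) (.snd (.snd .id))) (.snd (.snd .id)) .nil
    ⟨.X + 1, fun x a l => by
      have h₁ := size_ofList_le_of_sublist (select_sublist x.snd.snd.toList fun a =>
        a ∉ l.toList ∧ ∀ b ∈ x.snd.snd.toList, b ∉ l.toList →
          b = a ∨ cons b a ∈ HyperSep.maximalRel x)
      rw [ofList_toList] at h₁
      have h₂ := ((size_fst_le _).trans h₁).trans (x.snd.size_snd_le.trans x.size_snd_le)
      simp only [HyperSep.prepend, ofList, ofList_toList, size, Polynomial.eval_add,
        Polynomial.eval_X, Polynomial.eval_one]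
      lia⟩
  have key : ∀ (x : Val) (l : List Val), l.foldr (fun _ b => ofList (HyperSep.prepend x b.toList))
      .nil = ofList (l.foldr (fun _ b => HyperSep.prepend x b) []) := by
    intro x l
    induction l with
    | nil => rfl
    | cons a l ih => simp [ih]
  simpa only [key, HyperSep.sorted] using h

theorem PolyTime.separatorVal : PolyTime separatorVal := by
  refine .ite (.and (.consistent .id .maximalRel) ?_) (.pair .nil .sorted) .nil
  exact .forall_mem (P := fun x a => ∀ b ∈ x.snd.snd.toList,
      a = b ∨ cons a b ∈ HyperSep.maximalRel x ∨ cons b a ∈ HyperSep.maximalRel x)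
    (.forall_mem (P := fun z b => z.snd = b ∨ cons z.snd b ∈ HyperSep.maximalRel z.fst ∨
        cons b z.snd ∈ HyperSep.maximalRel z.fst)
      (.or (.eq (.snd (.fst .id)) (.snd .id))
        (.or (.mem_list (.pair (.snd (.fst .id)) (.snd .id))
            (PolyTime.maximalRel.comp (.fst (.fst .id))))
          (.mem_list (.pair (.snd .id) (.snd (.fst .id)))
            (PolyTime.maximalRel.comp (.fst (.fst .id))))))
      (.snd (.snd (.fst .id))))
    (.snd (.snd .id))
/-! ### Its correctness on values -/

theorem mem_pairs {l : List Val} {p : Val} : p ∈ pairs l ↔ ∃ a ∈ l, ∃ b ∈ l, p = cons a b := by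
  simp [pairs, eq_comm]

/-- The elements of `A` in the input `x = (V, E, A)`. -/
abbrev Item (x : Val) : Type := {a : Val // a ∈ x.snd.snd.toList}

/-- `v` is an entry of `a`. -/
def IsEntry (x : Val) (v : Val) (a : Item x) : Prop := v ∈ a.1.toList

/-- The relation on the elements of `A` given by a list of pairs. -/
def relOf (x : Val) (R : List Val) (a b : Item x) : Prop := cons a.1 b.1 ∈ R

/-- A compatible linear order in which `a` precedes `b` whenever it has to. -/
structure IsSolution (x : Val) (L : Item x → Item x → Prop) : Prop
    extends IsCompatibleOrder (IsEntry x) L where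
  of_precedes : ∀ {a b}, Precedes x a.1 b.1 → L a b

instance (x : Val) : Finite (Item x) := (List.finite_toSet x.snd.snd.toList).to_subtype

theorem mem_hull {x : Val} {R : List Val} {a b : Item x}
    (h : Implies x R (hull x R) (cons a.1 b.1)) : cons a.1 b.1 ∈ hull x R :=
  mem_closure (mem_pairs.2 ⟨_, a.2, _, b.2, rfl⟩) h

theorem isCompatible_hull {x : Val} {R : List Val} (h : Consistent x (hull x R)) :
    IsCompatible (IsEntry x) (relOf x (hull x R)) where
  trans {_ b _} h₁ h₂ := mem_hull (.inr (.inr (.inl ⟨b, b.2, h₁, h₂⟩)))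
  irrefl a := h a a.2
  left {a _ _} hs h₁ := mem_hull (.inr (.inr (.inr (.inl ⟨a, a.2, h₁, hs⟩))))
  right {a _ _} hs h₁ := mem_hull (.inr (.inr (.inr (.inr ⟨a, a.2, h₁, hs⟩))))

/-- A solution satisfies every rule of `Implies`, so it absorbs the whole closure of any relation it
contains. -/
theorem hull_subset {x : Val} {R : List Val} {L : Item x → Item x → Prop} (hL : IsSolution x L)
    (hR : ∀ a b : Item x, relOf x R a b → L a b) (a b : Item x) :
    relOf x (hull x R) a b → L a b := by
  suffices ∀ p ∈ hull x R, ∀ a b : Item x, p = cons a.1 b.1 → L a b from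
    fun h => this _ h a b rfl
  refine closure_induction fun W hW p _ hp a b hab => ?_
  subst hab
  rcases hp with h | h | ⟨c, hc, h₁, h₂⟩ | ⟨c, hc, h₁, h₂⟩ | ⟨c, hc, h₁, h₂⟩
  · exact hR a b h
  · exact hL.of_precedes h
  · exact hL.trans (hW _ h₁ a ⟨c, hc⟩ rfl) (hW _ h₂ ⟨c, hc⟩ b rfl)
  · exact hL.left (a := ⟨c, hc⟩) h₂ (hW _ h₁ ⟨c, hc⟩ b rfl)
  · exact hL.right (a := ⟨c, hc⟩) h₂ (hW _ h₁ a ⟨c, hc⟩ rfl)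

theorem isSolution_maximalRel {x : Val} (h : Solvable x) :
    IsSolution x (relOf x (maximalRel x)) := by
  have key : ∀ l : List Val, ∃ R, l.foldr (extend x) (hull x []) = hull x R := by
    intro l
    induction l with
    | nil => exact ⟨_, rfl⟩
    | cons p l ih =>
      rw [List.foldr_cons, extend]
      split
      · exact ⟨_, rfl⟩
      · exact ih
  obtain ⟨R, hR⟩ : ∃ R, maximalRel x = hull x R := key _
  refine ⟨⟨?_, fun {a b} hab => ?_⟩, fun {a b} hab => ?_⟩
  · rw [hR]
    exact isCompatible_hull (hR ▸ h.1)
  · exact (h.2 a a.2 b b.2).resolve_left fun h => hab (Subtype.ext h)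
  · unfold relOf
    rw [hR]
    exact mem_hull (.inr (.inl hab))

/-- By the extension theorem the final consistent relation lies in some solution `M`. No pair of `M`
can have been refused, so the relation is all of `M`, hence linear. -/
theorem solvable_of_isSolution {x : Val} {L : Item x → Item x → Prop} (hL : IsSolution x L) :
    Solvable x := by
  have hcons : ∀ {R M}, IsSolution x M → (∀ a b : Item x, relOf x R a b → M a b) →
      Consistent x (hull x R) := fun hM hR a ha h =>
    hM.irrefl ⟨a, ha⟩ (hull_subset hM hR _ _ h)
  have hext : ∀ {R}, Consistent x (hull x R) → ∃ M, IsSolution x M ∧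
      ∀ a b, relOf x (hull x R) a b → M a b := fun h => by
    obtain ⟨M, hM, hRM⟩ := (isCompatible_hull h).exists_extension hL.toIsCompatibleOrder
    exact ⟨M, ⟨hM, fun {a b} hab => hRM a b (mem_hull (.inr (.inl hab)))⟩, hRM⟩
  -- Invariant of the greedy loop: each pair tried so far is either present or excluded from all
  -- solutions that extend the current relation.
  have key : ∀ l ⊆ pairs x.snd.snd.toList, ∃ R, l.foldr (extend x) (hull x []) = hull x R ∧
      Consistent x (hull x R) ∧ ∀ a b : Item x, cons a.1 b.1 ∈ l → relOf x (hull x R) a b ∨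
        ∀ M, IsSolution x M → (∀ a b, relOf x (hull x R) a b → M a b) → ¬ M a b := by
    intro l
    induction l with
    | nil => exact fun _ => ⟨_, rfl, hcons hL (by simp [relOf]), by simp⟩
    | cons p l ih =>
      intro hl
      obtain ⟨R, hR, hc, hmax⟩ := ih (List.subset_of_cons_subset hl)
      rw [List.foldr_cons, extend, hR]
      have hmono : ∀ a b : Item x, relOf x (hull x R) a b →
          relOf x (hull x (p :: hull x R)) a b := fun a b h => mem_hull (.inl (List.mem_cons_of_mem _ h))
      split
      · next hc' =>
        refine ⟨_, rfl, hc', fun a b hab => ?_⟩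
        rcases List.mem_cons.1 hab with rfl | hab
        · exact .inl (mem_hull (.inl (by simp)))
        · exact (hmax a b hab).imp (hmono a b)
            fun h M hM hRM => h M hM fun a b hab => hRM a b (hmono a b hab)
      · next hc' =>
        refine ⟨_, rfl, hc, fun a b hab => ?_⟩
        rcases List.mem_cons.1 hab with rfl | hab
        · refine .inr fun M hM hRM h => hc' (hcons hM fun a' b' hab' => ?_)
          rcases List.mem_cons.1 hab' with h' | h'
          · cases a; cases b; cases a'; cases b'
            simp only [cons.injEq] at h'
            obtain ⟨rfl, rfl⟩ := h'
            exact h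
          · exact hRM a' b' h'
        · exact hmax a b hab
  obtain ⟨R, hR, hc, hmax⟩ := key _ (List.Subset.refl _)
  change maximalRel x = _ at hR
  obtain ⟨M, hM, hRM⟩ := hext hc
  rw [Solvable, hR]
  refine ⟨hc, fun a ha b hb => ?_⟩
  by_cases hab : a = b
  · exact .inl hab
  have hsub : ∀ {a b : Item x}, M a b → relOf x (hull x R) a b := fun {a b} h =>
    (hmax a b (mem_pairs.2 ⟨_, a.2, _, b.2, rfl⟩)).resolve_right fun h' => h' M hM hRM h
  exact .inr ((hM.total (a := ⟨a, ha⟩) (b := ⟨b, hb⟩) (by simpa using hab)).imp hsub hsub)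

/-- The list is built from its end: every element not yet listed precedes all listed ones, so a
maximal remaining element may be put in front. -/
theorem sorted_spec {x : Val} (hA : x.snd.snd.toList.Nodup) (h : Solvable x) :
    (sorted x).Nodup ∧ (∀ a, a ∈ sorted x ↔ a ∈ x.snd.snd.toList) ∧
      (sorted x).Pairwise fun a b => cons a b ∈ maximalRel x := by
  have hS := isSolution_maximalRel h
  set A := x.snd.snd.toList with hAdef
  have key : ∀ k : List Val, k.length ≤ A.length →
      let l := k.foldr (fun _ l => prepend x l) []
      l.Nodup ∧ l ⊆ A ∧ l.length = k.length ∧ (l.Pairwise fun a b => cons a b ∈ maximalRel x) ∧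
        ∀ a ∈ A, a ∉ l → ∀ b ∈ l, cons a b ∈ maximalRel x := by
    intro k
    induction k with
    | nil => simp
    | cons c k ih =>
      intro hk
      rw [List.length_cons] at hk
      obtain ⟨h₁, h₂, h₃, h₄, h₅⟩ := ih (by lia)
      simp only [List.foldr_cons]
      set l := k.foldr (fun _ l => prepend x l) []
      obtain ⟨m, hm, hml, hmax⟩ : ∃ m ∈ A, m ∉ l ∧
          ∀ b ∈ A, b ∉ l → b = m ∨ cons b m ∈ maximalRel x := by
        have hne : ∃ a : Item x, a.1 ∉ l := by
          by_contra! hn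
          have : A ⊆ l := fun a ha => hn ⟨a, ha⟩
          have := (List.subperm_of_subset hA this).length_le
          lia
        -- The relation is swapped so that a minimal element is a maximal one of the order.
        have : IsTrans (Item x) (Function.swap (relOf x (maximalRel x))) :=
          ⟨fun _ _ _ h h' => hS.trans h' h⟩
        have : Std.Irrefl (Function.swap (relOf x (maximalRel x))) := ⟨hS.irrefl⟩
        obtain ⟨m, hm, hmin⟩ := (Finite.wellFounded_of_trans_of_irrefl
          (Function.swap (relOf x (maximalRel x)))).has_min {a | a.1 ∉ l} hne
        refine ⟨m, m.2, hm, fun b hb hbl => ?_⟩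
        by_cases hbm : b = m
        · exact .inl hbm
        · exact .inr ((hS.total (a := ⟨b, hb⟩) (b := m) (fun h => hbm (congrArg Subtype.val h))).resolve_right
            (hmin ⟨b, hb⟩ hbl))
      obtain ⟨m, r, hsel⟩ : ∃ m r, (select A fun a => a ∉ l ∧
          ∀ b ∈ A, b ∉ l → b = a ∨ cons b a ∈ maximalRel x) = m :: r :=
        List.exists_cons_of_ne_nil (List.ne_nil_of_mem (mem_select.2 ⟨hm, hml, hmax⟩))
      have hp : prepend x l = m :: l := by
        rw [prepend, hsel]
        rfl
      obtain ⟨hm, hml, hmax⟩ := mem_select.1 (hsel ▸ List.mem_cons_self : m ∈ select A _)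
      rw [hp]
      refine ⟨List.nodup_cons.2 ⟨hml, h₁⟩, by simp [hm, h₂], by simp [h₃],
        List.pairwise_cons.2 ⟨h₅ m hm hml, h₄⟩, fun a ha hal b hb => ?_⟩
      simp only [List.mem_cons, not_or] at hal hb
      rcases hb with rfl | hb
      · exact (hmax a ha hal.2).resolve_left hal.1
      · exact h₅ a ha hal.2 b hb
  obtain ⟨h₁, h₂, h₃, h₄, -⟩ := key A le_rfl
  refine ⟨h₁, fun a => ⟨fun h => h₂ h, fun h => ?_⟩, h₄⟩
  exact ((List.subperm_of_subset h₁ h₂).perm_of_length_le h₃.ge).mem_iff.2 h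

/-- `u` and `w` are joined by a path of edges outside `A`. -/
theorem mem_joined {x u w : Val} (hV : ∀ u w, Adjoins x u w → w ∈ x.fst.toList)
    (hu : u ∈ x.fst.toList) :
    cons u w ∈ joined x ↔ w ∈ x.fst.toList ∧ Relation.ReflTransGen (Adjoins x) u w := by
  constructor
  · intro h
    have key : ∀ p ∈ joined x, Relation.ReflTransGen (Adjoins x) p.fst p.snd := by
      refine closure_induction fun W hW p _ hp => ?_
      rcases hp with h | ⟨v, _, h₁, h₂⟩
      · rw [h]
      · exact .tail (hW (cons p.fst v) h₁) h₂
    have hmem := (closure_sublist _ _).subset h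
    rw [mem_pairs] at hmem
    obtain ⟨a, _, b, hb, hab⟩ := hmem
    cases hab
    exact ⟨hb, key _ h⟩
  · rintro ⟨-, h⟩
    suffices w ∈ x.fst.toList ∧ cons u w ∈ joined x from this.2
    induction h with
    | refl => exact ⟨hu, mem_closure (mem_pairs.2 ⟨_, hu, _, hu, rfl⟩) (.inl rfl)⟩
    | @tail v w _ hvw ih =>
      have hw := hV _ _ hvw
      exact ⟨hw, mem_closure (mem_pairs.2 ⟨_, hu, _, hw, rfl⟩) (.inr ⟨v, ih.1, ih.2, hvw⟩)⟩

/-! ### Components -/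

section Components

variable {α : Type u} {G C : Hypergraph α} {u w : α}

theorem HasPath.reflTransGen_adj (h : HasPath G u w) : Relation.ReflTransGen G.Adj u w := by
  obtain ⟨e, he, f, hf, hu, hw, h⟩ := h
  induction h generalizing w with
  | refl => exact .single ⟨e, he, hu, hw⟩
  | tail _ hgf ih =>
    obtain ⟨hg, _, v, hvg, hvf⟩ := hgf
    exact .tail (ih hg hvg) ⟨_, hf, hvf, hw⟩

theorem hasPath_of_reflTransGen {e : Set α} (he : e ∈ G.edgeSet) (hu : u ∈ e)
    (h : Relation.ReflTransGen G.Adj u w) : HasPath G u w := by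
  induction h with
  | refl => exact ⟨e, he, e, he, hu, hu, .refl⟩
  | tail _ hvw ih =>
    obtain ⟨f, hf, g, hg, huf, hvg, hfg⟩ := ih
    obtain ⟨k, hk, hvk, hwk⟩ := hvw
    exact ⟨f, hf, k, hk, huf, hwk, .tail hfg ⟨hg, hk, _, hvg, hvk⟩⟩

theorem IsSub.adj (h : IsSub C G) {v w : α} (hvw : C.Adj v w) : G.Adj v w := by
  obtain ⟨f, hf, hv, hw⟩ := hvw
  obtain ⟨-, e, he, rfl⟩ := h.2 hf
  exact ⟨e, he, hv.1, hw.1⟩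

theorem IsSub.reflTransGen_adj (h : IsSub C G) (hC : IsConn C) (hu : u ∈ C.vertexSet)
    (hw : w ∈ C.vertexSet) : Relation.ReflTransGen G.Adj u w :=
  (hC u hu w hw).reflTransGen_adj.lift id fun _ _ => h.adj

/-- The component consists of all vertices reachable from `u`, with every nonempty trace of an edge
on them. A larger connected subhypergraph gains no vertex, being reachable from `u` itself, and
hence no edge. -/
theorem exists_isComponent {e : Set α} (he : e ∈ G.edgeSet) (hu : u ∈ e) :
    ∃ C, IsComponent G C ∧ ∀ w, w ∈ C.vertexSet ↔ Relation.ReflTransGen G.Adj u w := by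
  let K : Set α := {w | Relation.ReflTransGen G.Adj u w}
  let C : Hypergraph α :=
    { vertexSet := K
      edgeSet := {f | f.Nonempty ∧ ∃ e ∈ G.edgeSet, f = e ∩ K}
      subset_vertexSet_of_mem_edgeSet' := by
        rintro _ ⟨-, e, -, rfl⟩
        exact Set.inter_subset_right }
  have hK : ∀ v ∈ K, ∃ f ∈ G.edgeSet, v ∈ f := fun v hv => by
    rcases Relation.ReflTransGen.cases_tail hv with rfl | ⟨_, _, f, hf, _, hvf⟩
    · exact ⟨e, he, hu⟩
    · exact ⟨f, hf, hvf⟩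
  have hadj : ∀ v ∈ K, ∀ w, G.Adj v w → C.Adj v w := by
    rintro v hv w ⟨f, hf, hvf, hwf⟩
    have hw : w ∈ K := .tail hv ⟨f, hf, hvf, hwf⟩
    exact ⟨f ∩ K, ⟨⟨v, hvf, hv⟩, f, hf, rfl⟩, ⟨hvf, hv⟩, ⟨hwf, hw⟩⟩
  have hsymm : ∀ {v w}, Relation.ReflTransGen G.Adj v w → Relation.ReflTransGen G.Adj w v :=
    fun h => by
      induction h with
      | refl => exact .refl
      | tail _ h ih => exact .head h.symm ih
  refine ⟨C, ⟨⟨fun v hv => ?_, fun f hf => hf⟩, fun v hv w hw => ?_, fun D hD hDc hCD => ?_⟩,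
    fun w => .rfl⟩
  · obtain ⟨f, hf, hvf⟩ := hK v hv
    exact Hypergraph.mem_vertexSet_of_mem_edgeSet hf hvf
  · obtain ⟨f, hf, hvf⟩ := hK v hv
    refine hasPath_of_reflTransGen (e := f ∩ K) ⟨⟨v, hvf, hv⟩, f, hf, rfl⟩ ⟨hvf, hv⟩ ?_
    have hvw : Relation.ReflTransGen G.Adj v w := (hsymm hv).trans hw
    induction hvw with
    | refl => exact .refl
    | @tail b c hvb hbc ih =>
      have hb : b ∈ K := Relation.ReflTransGen.trans hv hvb
      exact .tail (ih hb) (hadj b hb c hbc)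
  · have hV : D.vertexSet = K := by
      refine Set.Subset.antisymm (fun w hw => ?_) hCD.1
      exact hD.reflTransGen_adj hDc (hCD.1 (show u ∈ K from .refl)) hw
    refine Hypergraph.ext hV (Set.Subset.antisymm (fun f hf => ?_) fun f hf => ?_)
    · have := hD.2 hf
      rwa [hV] at this
    · obtain ⟨-, g, hg, rfl⟩ := hCD.2 hf
      have : g ∩ C.vertexSet = g :=
        Set.inter_eq_left.2 (Hypergraph.subset_vertexSet_of_mem_edgeSet hg |>.trans hV.subset)
      rwa [this]

end Components

/-! ### Decoding -/

section Decoding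

variable {α : Type u} {name : α → Val} {S : Set α}

/-- The vertices in `S` that have their names in the list `y`. -/
def decode (name : α → Val) (S : Set α) (y : Val) : Set α :=
  {v ∈ S | name v ∈ y.toList}

theorem EncVerts.mem_toList {e : Set α} {y w : Val} (h : EncVerts name e y) :
    w ∈ y.toList ↔ ∃ v ∈ e, name v = w := by
  obtain ⟨l, -, hl, ys, hys, rfl⟩ := h
  have key : ∀ (l : List α) (ys : List Val), List.Forall₂ (fun v y => y = name v) l ys →
      ys = l.map name := by
    intro l ys h
    induction h with
    | nil => rfl
    | cons h _ ih => rw [h, ih, List.map_cons]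
  simp [key l ys hys, hl]

theorem EncVerts.decode_eq (hn : Set.InjOn name S) {e : Set α} (he : e ⊆ S) {y : Val}
    (h : EncVerts name e y) : decode name S y = e := by
  ext v
  simp only [decode, Set.mem_ofPred_eq, h.mem_toList]
  constructor
  · rintro ⟨hv, w, hw, hwv⟩
    rwa [← hn (he hw) hv hwv]
  · exact fun hv => ⟨he hv, v, hv, rfl⟩

theorem EncSet.decode (hn : Set.InjOn name S) {T : Set (Set α)} (hT : ∀ e ∈ T, e ⊆ S) {y : Val}
    (h : EncSet (EncVerts name) T y) :
    (y.toList.map (decode name S)).Nodup ∧ (∀ e, e ∈ y.toList.map (decode name S) ↔ e ∈ T) ∧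
      ∀ a ∈ y.toList, EncVerts name (HyperSep.decode name S a) a := by
  obtain ⟨l, hl, hlT, ys, hys, rfl⟩ := h
  have key : ∀ l : List (Set α), (∀ e ∈ l, e ∈ T) → ∀ ys, List.Forall₂ (EncVerts name) l ys →
      ys.map (HyperSep.decode name S) = l ∧
        ∀ a ∈ ys, EncVerts name (HyperSep.decode name S a) a := by
    intro l hl ys h
    induction h with
    | nil => simp
    | @cons e a l ys h _ ih =>
      obtain ⟨h₁, h₂⟩ := ih fun f hf => hl f (by simp [hf])
      have he := h.decode_eq hn (hT e (hl e (by simp)))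
      refine ⟨by simp [h₁, he], fun b hb => ?_⟩
      rcases List.mem_cons.1 hb with rfl | hb
      · rwa [he]
      · exact h₂ b hb
  obtain ⟨h₁, h₂⟩ := key l (fun e he => (hlT e).1 he) ys hys
  rw [toList_ofList, h₁]
  exact ⟨hl, hlT, h₂⟩

end Decoding

/-! ### Correctness -/

section Correctness

variable {α : Type u} {name : α → Val} {H : Hypergraph α} {A : Set (Set α)} {x : Val}

/-- `x` encodes `(H, A)`; here the edges are given by `decode`. -/
structure Represents (name : α → Val) (H : Hypergraph α) (A : Set (Set α)) (x : Val) : Prop where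
  injOn : Set.InjOn name H.vertexSet
  mem_verts : ∀ w, w ∈ x.fst.toList ↔ ∃ v ∈ H.vertexSet, name v = w
  mem_edges : ∀ e, (∃ a ∈ x.snd.fst.toList, decode name H.vertexSet a = e) ↔ e ∈ H.edgeSet
  code_edges : ∀ a ∈ x.snd.fst.toList, EncVerts name (decode name H.vertexSet a) a
  mem_items : ∀ e, (∃ a ∈ x.snd.snd.toList, decode name H.vertexSet a = e) ↔ e ∈ A
  code_items : ∀ a ∈ x.snd.snd.toList, EncVerts name (decode name H.vertexSet a) a
  nodup : (x.snd.snd.toList.map (decode name H.vertexSet)).Nodup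

theorem EncInput.represents (hn : Set.InjOn name H.vertexSet) (hA : A ⊆ H.edgeSet)
    (h : EncInput name H A x) : Represents name H A x := by
  obtain ⟨xV, xE, xA, rfl, hV, hE, hA'⟩ := h
  obtain ⟨-, hE₁, hE₂⟩ := hE.decode hn fun _ => Hypergraph.subset_vertexSet_of_mem_edgeSet
  obtain ⟨hA₀, hA₁, hA₂⟩ := hA'.decode hn fun _ he =>
    Hypergraph.subset_vertexSet_of_mem_edgeSet (hA he)
  exact ⟨hn, fun w => hV.mem_toList, by simpa using hE₁, hE₂, by simpa using hA₁, hA₂, hA₀⟩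

namespace Represents

theorem mem_decode (h : Represents name H A x) {a w : Val} (ha : a ∈ x.snd.snd.toList) :
    w ∈ a.toList ↔ ∃ v ∈ decode name H.vertexSet a, name v = w :=
  (h.code_items a ha).mem_toList

theorem decode_mem (h : Represents name H A x) (a : Item x) : decode name H.vertexSet a.1 ∈ A :=
  (h.mem_items _).1 ⟨a.1, a.2, rfl⟩

theorem decode_injective (h : Represents name H A x) {a b : Item x}
    (hab : decode name H.vertexSet a.1 = decode name H.vertexSet b.1) : a = b :=
  Subtype.ext (List.inj_on_of_nodup_map h.nodup a.2 b.2 hab)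

theorem adjoins_iff (h : Represents name H A x) {u w : Val} :
    Adjoins x u w ↔ ∃ u' w', (del H A).Adj u' w' ∧ name u' = u ∧ name w' = w := by
  have hsame : ∀ e ∈ x.snd.fst.toList, ∀ a ∈ x.snd.snd.toList,
      SameEntries e a ↔ decode name H.vertexSet e = decode name H.vertexSet a := by
    refine fun e he a ha => ⟨fun ⟨h₁, h₂⟩ => Set.ext fun v => ?_, fun hea => ?_⟩
    · exact ⟨fun hv => ⟨hv.1, h₁ _ hv.2⟩, fun hv => ⟨hv.1, h₂ _ hv.2⟩⟩
    · have : ∀ v, v ∈ e.toList ↔ v ∈ a.toList := fun v => by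
        rw [(h.code_edges e he).mem_toList, (h.code_items a ha).mem_toList, hea]
      exact ⟨fun v => (this v).1, fun v => (this v).2⟩
  constructor
  · rintro ⟨e, he, hea, hu, hw⟩
    obtain ⟨u', hu', rfl⟩ := (h.code_edges e he).mem_toList.1 hu
    obtain ⟨w', hw', rfl⟩ := (h.code_edges e he).mem_toList.1 hw
    refine ⟨u', w', ⟨_, ⟨(h.mem_edges _).1 ⟨e, he, rfl⟩, fun hA => hea ?_⟩, hu', hw'⟩, rfl, rfl⟩
    obtain ⟨a, ha, hae⟩ := (h.mem_items _).2 hA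
    exact ⟨a, ha, (hsame e he a ha).2 hae.symm⟩
  · rintro ⟨u', w', ⟨f, ⟨hf, hfA⟩, hu, hw⟩, rfl, rfl⟩
    obtain ⟨e, he, rfl⟩ := (h.mem_edges f).2 hf
    refine ⟨e, he, ?_, hu.2, hw.2⟩
    rintro ⟨a, ha, hea⟩
    exact hfA ((hsame e he a ha).1 hea ▸ h.decode_mem ⟨a, ha⟩)

theorem mem_joined (h : Represents name H A x) {u w : α} (hu : u ∈ H.vertexSet)
    (hw : w ∈ H.vertexSet) :
    cons (name u) (name w) ∈ joined x ↔ Relation.ReflTransGen (del H A).Adj u w := by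
  have hmem : ∀ {v w}, (del H A).Adj v w → v ∈ H.vertexSet ∧ w ∈ H.vertexSet :=
    fun ⟨e, he, hv, hw⟩ => ⟨Hypergraph.mem_vertexSet_of_mem_edgeSet he.1 hv,
      Hypergraph.mem_vertexSet_of_mem_edgeSet he.1 hw⟩
  rw [HyperSep.mem_joined, h.mem_verts]
  · constructor
    · rintro ⟨-, hp⟩
      have key : ∀ p, Relation.ReflTransGen (Adjoins x) (name u) p → ∃ v ∈ H.vertexSet,
          name v = p ∧ Relation.ReflTransGen (del H A).Adj u v := by
        intro p hp
        induction hp with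
        | refl => exact ⟨u, hu, rfl, .refl⟩
        | tail _ hab ih =>
          obtain ⟨v, hv, rfl, huv⟩ := ih
          obtain ⟨v', w', hvw, hv', rfl⟩ := h.adjoins_iff.1 hab
          obtain rfl := h.injOn (hmem hvw).1 hv hv'
          exact ⟨w', (hmem hvw).2, rfl, .tail huv hvw⟩
      obtain ⟨v, hv, hvw, huv⟩ := key _ hp
      rwa [← h.injOn hv hw hvw]
    · exact fun hp => ⟨⟨w, hw, rfl⟩, hp.lift name fun a b hab => h.adjoins_iff.2 ⟨a, b, hab, rfl, rfl⟩⟩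
  · intro u w huw
    obtain ⟨_, w', hw', -, rfl⟩ := h.adjoins_iff.1 huw
    exact (h.mem_verts _).2 ⟨w', (hmem hw').2, rfl⟩
  · exact (h.mem_verts _).2 ⟨u, hu, rfl⟩

/-- This is the negation of the component condition for `b` placed before `a`. It translates
reachability by edges outside `A` into membership in a common component. -/
theorem precedes_iff (h : Represents name H A x) (a b : Item x) :
    Precedes x a.1 b.1 ↔ ∃ C, IsComponent (del H A) C ∧
      (decode name H.vertexSet a.1 ∩ C.vertexSet).Nonempty ∧
      ¬ decode name H.vertexSet b.1 ∩ C.vertexSet ⊆ decode name H.vertexSet a.1 ∩ C.vertexSet := by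
  constructor
  · rintro ⟨_, hua, _, hwb, hwa, huw⟩
    obtain ⟨u, hu, rfl⟩ := (h.mem_decode a.2).1 hua
    obtain ⟨w, hw, rfl⟩ := (h.mem_decode b.2).1 hwb
    rw [h.mem_joined hu.1 hw.1] at huw
    -- Distinctness makes the path nontrivial, so `u` lies in an edge outside `A` and therefore in a
    -- component.
    have hne : u ≠ w := by
      rintro rfl
      exact hwa hua
    obtain ⟨e, he, hue⟩ : ∃ e ∈ (del H A).edgeSet, u ∈ e := by
      rcases Relation.ReflTransGen.cases_head huw with h | ⟨_, ⟨e, he, hue, _⟩, _⟩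
      · exact absurd h hne
      · exact ⟨e, he, hue⟩
    obtain ⟨C, hC, hCu⟩ := exists_isComponent he hue
    exact ⟨C, hC, ⟨u, hu, (hCu u).2 .refl⟩, fun hsub => hwa (hsub ⟨hw, (hCu w).2 huw⟩).1.2⟩
  · rintro ⟨C, hC, ⟨u, hu, huC⟩, hsub⟩
    obtain ⟨w, ⟨hw, hwC⟩, hwa⟩ := Set.not_subset.1 hsub
    refine ⟨name u, hu.2, name w, hw.2, fun hwa' => hwa ⟨⟨hw.1, hwa'⟩, hwC⟩, ?_⟩
    exact (h.mem_joined hu.1 hw.1).2 (hC.1.reflTransGen_adj hC.2.1 huC hwC)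

/-- Order the codes by the positions of their edges in `P`. The join path condition rules out the
forbidden positions in between, and the component condition yields the prescribed comparisons. -/
theorem exists_isSolution (h : Represents name H A x) {P : List (Set α)}
    (hP : IsSeparator H A P) : ∃ L, IsSolution x L := by
  classical
  obtain ⟨⟨-, hmem, hjoin⟩, hsep⟩ := hP
  have hpos : ∀ a : Item x, ∃ i : Fin P.length, P.get i = decode name H.vertexSet a.1 :=
    fun a => List.mem_iff_get.1 ((hmem _).2 (h.decode_mem a))
  choose pos hpos using hpos
  have hsplit : ∀ {a b c : Item x}, Splits (IsEntry x) a b c →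
      ¬ (pos a ≤ pos c ∧ pos c ≤ pos b) := by
    rintro a b c ⟨v, hva, hvb, hvc⟩ ⟨hac, hcb⟩
    obtain ⟨v, hv, rfl⟩ := (h.mem_decode a.2).1 hva
    have := hjoin _ _ _ hac hcb
    rw [hpos, hpos, hpos] at this
    exact hvc (this ⟨hv, hv.1, hvb⟩).2
  refine ⟨fun a b => pos a < pos b, ⟨⟨fun h₁ h₂ => h₁.trans h₂, fun a => lt_irrefl _, ?_, ?_⟩,
    fun {a b} hab => ?_⟩, fun {a b} hab => ?_⟩
  · exact fun hs hac => lt_of_not_ge fun hcb => hsplit hs ⟨hac.le, hcb⟩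
  · exact fun hs hca => lt_of_not_ge fun hbc => hsplit hs.symm ⟨hbc, hca.le⟩
  · refine lt_or_gt_of_ne fun he => hab (h.decode_injective ?_)
    rw [← hpos, ← hpos, he]
  · obtain ⟨C, hC, hne, hsub⟩ := (h.precedes_iff a b).1 hab
    refine lt_of_not_ge fun hba => hsub ?_
    have := hsep C hC _ _ hba
    rw [hpos, hpos] at this
    exact this hne

theorem isSeparator (h : Represents name H A x) {L : Item x → Item x → Prop}
    (hL : IsSolution x L) {l : List Val} (hl : l.Nodup) (hmem : ∀ a, a ∈ l ↔ a ∈ x.snd.snd.toList)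
    (hsort : l.Pairwise fun a b => ∀ ha hb, L ⟨a, ha⟩ ⟨b, hb⟩) :
    IsSeparator H A (l.map (decode name H.vertexSet)) := by
  set P := l.map (decode name H.vertexSet) with hPdef
  have hlen : P.length = l.length := List.length_map _
  let item : Fin P.length → Item x := fun i =>
    ⟨l.get (i.cast hlen), (hmem _).1 (List.get_mem _ _)⟩
  have hget : ∀ i, P.get i = decode name H.vertexSet (item i).1 := fun i => by
    simp [P, item]
  have hlt : ∀ {i j}, i < j → L (item i) (item j) := fun {i j} hij =>
    List.pairwise_iff_get.1 hsort (i.cast hlen) (j.cast hlen) hij _ _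
  refine ⟨⟨?_, fun e => ?_, fun i k j hik hkj => ?_⟩, fun C hC i j hij hne => ?_⟩
  · exact hl.map_on fun a ha b hb hab =>
      List.inj_on_of_nodup_map h.nodup ((hmem a).1 ha) ((hmem b).1 hb) hab
  · rw [← h.mem_items]
    simp [P, hmem]
  · rcases hik.eq_or_lt with rfl | hik
    · exact Set.inter_subset_left
    rcases hkj.eq_or_lt with rfl | hkj
    · exact Set.inter_subset_right
    rw [hget, hget, hget]
    rintro v ⟨hvi, hvj⟩
    by_contra hvk
    -- A vertex missing from the middle edge would force the last edge to precede the middle one.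
    have hs : Splits (IsEntry x) (item i) (item j) (item k) :=
      ⟨name v, hvi.2, hvj.2, fun hv => hvk ⟨hvi.1, hv⟩⟩
    exact hL.asymm (hL.left hs (hlt hik)) (hlt hkj)
  · rcases hij.eq_or_lt with rfl | hij
    · exact subset_rfl
    rw [hget] at hne
    rw [hget, hget]
    by_contra hsub
    exact hL.asymm (hL.of_precedes ((h.precedes_iff _ _).2 ⟨C, hC, hne, hsub⟩)) (hlt hij)

theorem separatorVal_returns (h : Represents name H A x) (hP : ∃ P, IsSeparator H A P) :
    ∃ P, IsSeparator H A P ∧ returns name P (separatorVal x) := by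
  obtain ⟨P, hP⟩ := hP
  obtain ⟨L, hL⟩ := h.exists_isSolution hP
  have hx := solvable_of_isSolution hL
  obtain ⟨h₁, h₂, h₃⟩ := sorted_spec (h.nodup.of_map _) hx
  refine ⟨_, h.isSeparator (isSolution_maximalRel hx) h₁ h₂ (h₃.imp fun hab _ _ => hab), _,
    if_pos hx, _, ?_, rfl⟩
  rw [List.forall₂_map_left_iff, List.forall₂_same]
  exact fun a ha => h.code_items a ((h₂ a).1 ha)

theorem separatorVal_rejects (h : Represents name H A x) (hP : ¬ ∃ P, IsSeparator H A P) :
    rejects (separatorVal x) := by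
  refine if_neg fun hx => hP ?_
  obtain ⟨h₁, h₂, h₃⟩ := sorted_spec (h.nodup.of_map _) hx
  exact ⟨_, h.isSeparator (isSolution_maximalRel hx) h₁ h₂ (h₃.imp fun hab _ _ => hab)⟩

end Represents

end Correctness

end HyperSep

theorem mainTheorem4 :
    ∃ (computeSeparator : HyperSep.Prog) (q : Polynomial ℕ),
      ∀ (α : Type u) (name : α → HyperSep.Val) (H : Hypergraph α) (A : Set (Set α))
        (x : HyperSep.Val),
        H.vertexSet.Finite → Set.InjOn name H.vertexSet → A ⊆ H.edgeSet →
        HyperSep.EncInput name H A x →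
          ∃ (y : HyperSep.Val) (t : ℕ),
            computeSeparator.Runs x y t ∧ t ≤ q.eval x.size ∧
              ((∃ P, HyperSep.IsSeparator H A P) →
                ∃ P, HyperSep.IsSeparator H A P ∧ HyperSep.returns name P y) ∧
              ((¬ ∃ P, HyperSep.IsSeparator H A P) → HyperSep.rejects y) := by
  obtain ⟨p, q, hp⟩ := HyperSep.PolyTime.separatorVal
  refine ⟨p, q, fun α name H A x _ hn hA hx => ?_⟩
  obtain ⟨t, ht, htq⟩ := hp x
  have h := hx.represents hn hA
  exact ⟨_, t, ht, htq, h.separatorVal_returns, h.separatorVal_rejects⟩
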